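/- Consider a norm on $\mathbb{R}^2$ with unit ball $U$ whose unit circle is smooth by parts: it is parametrized counterclockwise by a continuous curve $u:\mathbb{R}\to\mathbb{R}^2$ with $u(t+T)=-u(t)$, injective on $[0,2T)$, and there are points $0=t_0<t_1<\dots<t_{2n}=2T$ with $t_{i+n}=t_i+T$ such that $u$ is smooth with $u'\neq 0$ on each closed interval $[t_i,t_{i+1}]$ and, on each such interval, either $[u',u'']\neq 0$ or $u$ runs along a straight segment; two consecutive straight segments are not collinear. Here $[a,b]$ is the determinant with columns $a,b$, and derivatives at end points of intervals are one-sided. On each $[t_i,t_{i+1}]$ put $v=u'/[u,u']$. A curve $\gamma:\mathbb{R}\to\mathbb{R}^2$ is admissible if it is continuous and $2T$-periodic, is smooth on each $[t_i,t_{i+1}]$, and satisfies $\gamma'(t)=r(t)u'(t)$ there for some scalar function $r$, where $r$ is constant on every interval on which $u$ is a straight segment. Put $$A(\gamma)=\frac12\int_0^{2T}[\gamma,\gamma'](t)\,dt,\qquad L_*(\gamma)=\int_0^{2T}r(t)[u,u'](t)\,dt,\qquad w_\gamma=\frac{L_*(\gamma)}{A(u)},$$ where $A(u)$ is the area of $U$,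 and define the Wigner caustic and the constant width measure set of $\gamma$ by $$WC(\gamma)(t)=\tfrac12\big(\gamma(t)+\gamma(t+T)\big),\qquad CWMS(\gamma)(t)=\tfrac12\big(\gamma(t)-\gamma(t+T)-w_\gamma u(t)\big).$$ Then, for every admissible $\gamma$: 1. $A(WC(\gamma))\le 0$, with equality if and only if $\gamma$ is symmetric with respect to some point, i.e. there is $p\in\mathbb{R}^2$ with $\gamma(t+T)-p=-(\gamma(t)-p)$ for all $t$. 2. $A(CWMS(\gamma))\le 0$, with equality if and only if $\gamma$ is of constant width, i.e. there is a constant $c$ such that $[\gamma,v](t+T)+[\gamma,v](t)=c$ on all intervals $[t_i,t_{i+1}]$. -/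

import Mathlib

open Set
open scoped ContDiff

noncomputable section

/-- The determinant `[a, b]` of the `2 × 2` matrix with columns `a` and `b`. -/
def bracket (a b : ℝ × ℝ) : ℝ := a.1 * b.2 - a.2 * b.1

/-- One-sided at the end points: the velocity of `u` along the closed arc over `[a, b]`. -/
def arcDeriv (u : ℝ → ℝ × ℝ) (a b : ℝ) (s : ℝ) : ℝ × ℝ := derivWithin u (Icc a b) s

/-- `[u', u''] ≠ 0` along the closed arc of `u` over `[a, b]`. -/
def IsStrictlyConvexArc (u : ℝ → ℝ × ℝ) (a b : ℝ) : Prop :=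
  ∀ s ∈ Icc a b, bracket (arcDeriv u a b s) (arcDeriv (arcDeriv u a b) a b s) ≠ 0

/-- The arc of `u` over `[a, b]` is a straight segment. -/
def IsStraightArc (u : ℝ → ℝ × ℝ) (a b : ℝ) : Prop :=
  u '' Icc a b = segment ℝ (u a) (u b)

/-- A normed plane whose unit circle is smooth by parts, with a counterclockwise parametrization
`u` of the unit circle, of period `2T`, extended periodically to all of `ℝ`.
The division points `t 0 = 0 < t 1 < ⋯ < t (2n) = 2T` are continued to all `i : ℕ`
with `t (i + n) = t i + T`, so the arcs over `[t i, t (i+1)]`, `i < 2n`, are all the arcs. -/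
structure SmoothByPartsPlane where
  /-- the norm of the plane -/
  norm : Seminorm ℝ (ℝ × ℝ)
  norm_definite : ∀ x, norm x = 0 → x = 0
  /-- half of the period -/
  T : ℝ
  T_pos : 0 < T
  /-- half of the number of arcs -/
  n : ℕ
  n_pos : 0 < n
  /-- the division points -/
  t : ℕ → ℝ
  t_zero : t 0 = 0
  t_lt : ∀ i, t i < t (i + 1)
  t_add : ∀ i, t (i + n) = t i + T
  /-- the parametrization of the unit circle -/
  u : ℝ → ℝ × ℝ
  u_continuous : Continuous u
  u_antiperiodic : ∀ s, u (s + T) = -u s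
  u_injOn : InjOn u (Ico 0 (2 * T))
  u_image : u '' Icc 0 (2 * T) = {x | norm x = 1}
  u_smooth : ∀ i, ContDiffOn ℝ ∞ u (Icc (t i) (t (i + 1)))
  u_regular : ∀ i, ∀ s ∈ Icc (t i) (t (i + 1)), arcDeriv u (t i) (t (i + 1)) s ≠ 0
  u_counterclockwise : ∀ i, ∀ s ∈ Icc (t i) (t (i + 1)),
    0 < bracket (u s) (arcDeriv u (t i) (t (i + 1)) s)
  arc_type : ∀ i, IsStrictlyConvexArc u (t i) (t (i + 1)) ∨ IsStraightArc u (t i) (t (i + 1))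
  /-- Two consecutive straight arcs meet at a genuine vertex (they are not collinear). -/
  vertex : ∀ i, IsStraightArc u (t i) (t (i + 1)) → IsStraightArc u (t (i + 1)) (t (i + 2)) →
    bracket (u (t (i + 1)) - u (t i)) (u (t (i + 2)) - u (t (i + 1))) ≠ 0

namespace SmoothByPartsPlane

variable (P : SmoothByPartsPlane)

/-- The velocity of a curve along the `i`-th closed arc. -/
def velocity (γ : ℝ → ℝ × ℝ) (i : ℕ) (s : ℝ) : ℝ × ℝ := arcDeriv γ (P.t i) (P.t (i + 1)) s

/-- The dual curve `v = u' / [u, u']` along the `i`-th closed arc (it may jump at the division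
points). -/
def v (i : ℕ) (s : ℝ) : ℝ × ℝ :=
  (bracket (P.u s) (P.velocity P.u i s))⁻¹ • P.velocity P.u i s

/-- The class of admissible curves: closed, smooth by parts, with `γ' = r u'` along each arc.
Where `u` is a straight segment, `r` is the (constant) signed ratio of the lengths of the
corresponding segments of `γ` and `u`. -/
structure IsAdmissible (γ : ℝ → ℝ × ℝ) : Prop where
  continuous : Continuous γ
  periodic : ∀ s, γ (s + 2 * P.T) = γ s
  smooth : ∀ i, ContDiffOn ℝ ∞ γ (Icc (P.t i) (P.t (i + 1)))
  exists_radius : ∀ i, ∃ r : ℝ → ℝ,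
    (∀ s ∈ Icc (P.t i) (P.t (i + 1)), P.velocity γ i s = r s • P.velocity P.u i s) ∧
    (IsStraightArc P.u (P.t i) (P.t (i + 1)) →
      ∃ k : ℝ, ∀ s ∈ Icc (P.t i) (P.t (i + 1)), r s = k)

/-- The curvature radius: the scalar `r` with `γ' = r u'`, see `curvatureRadius_eq`. -/
def curvatureRadius (γ : ℝ → ℝ × ℝ) (s : ℝ) : ℝ :=
  bracket (P.u s) (deriv γ s) / bracket (P.u s) (deriv P.u s)

theorem curvatureRadius_eq (γ : ℝ → ℝ × ℝ) (s r : ℝ) (hr : deriv γ s = r • deriv P.u s)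
    (hu : bracket (P.u s) (deriv P.u s) ≠ 0) : P.curvatureRadius γ s = r := by
  unfold curvatureRadius
  rw [div_eq_iff hu, hr]
  simp only [bracket, Prod.smul_fst, Prod.smul_snd, smul_eq_mul]
  ring

/-- The signed dual length `L_*(γ) = ∫ r [u, u']`. -/
def dualLength (γ : ℝ → ℝ × ℝ) : ℝ :=
  ∫ s in (0 : ℝ)..(2 * P.T), P.curvatureRadius γ s * bracket (P.u s) (deriv P.u s)

/-- The mixed area of two curves. -/
def mixedArea (γ₁ γ₂ : ℝ → ℝ × ℝ) : ℝ :=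
  (1 / 2) * ∫ s in (0 : ℝ)..(2 * P.T), bracket (γ₁ s) (deriv γ₂ s)

/-- The signed area of a curve. -/
def signedArea (γ : ℝ → ℝ × ℝ) : ℝ := P.mixedArea γ γ

/-- The mean width `w = L_*(γ) / A(u)`, where `A(u)` is the area enclosed by the unit circle. -/
def meanWidth (γ : ℝ → ℝ × ℝ) : ℝ := P.dualLength γ / P.signedArea P.u

/-- The Wigner caustic. -/
def wignerCaustic (γ : ℝ → ℝ × ℝ) (s : ℝ) : ℝ × ℝ :=
  (1 / 2 : ℝ) • (γ s + γ (s + P.T))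

/-- The constant width measure set. -/
def constantWidthMeasureSet (γ : ℝ → ℝ × ℝ) (s : ℝ) : ℝ × ℝ :=
  (1 / 2 : ℝ) • (γ s - γ (s + P.T) - P.meanWidth γ • P.u s)

/-- The curve is symmetric with respect to some point `p` of the plane. -/
def IsSymmetric (γ : ℝ → ℝ × ℝ) : Prop :=
  ∃ p : ℝ × ℝ, ∀ s, γ (s + P.T) - p = -(γ s - p)

/-- The curve has constant width: `[γ, v](s + T) + [γ, v](s)` is constant.
Translation by `T` takes the `i`-th arc to the `(i + n)`-th. -/
def HasConstantWidth (γ : ℝ → ℝ × ℝ) : Prop :=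
  ∃ c : ℝ, ∀ i, ∀ s ∈ Icc (P.t i) (P.t (i + 1)),
    bracket (γ (s + P.T)) (P.v (i + P.n) (s + P.T)) + bracket (γ s) (P.v i s) = c

end SmoothByPartsPlane

end

/-! ### The determinant bracket -/

/-! Both inequalities come from one formula along a half turn. Let `X` be admissible, `X' = r u'`,
and let `e ≠ 0` satisfy `[e, u'] ≥ 0` on `[a, b]`, with `b ≤ a + T` and `[e, X] = 0` at `a` and `b`.
The function `F = [e, X] [X, u'] / [e, u']` has derivative `[X, X'] + [e, X]² [u', u''] / [e, u']²`,
and at a vertex it jumps by `[e, X]² [u'₋, u'₊] / ([e, u'₋] [e, u'₊])`. Convexity of the unit ball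
makes both extra terms nonnegative, and `F` vanishes at the ends, so `∫ [X, X'] ≤ 0`
(`IsChordDirection.integral_nonpos`). Zeros of `[e, u']` do no harm, because `[e, X]` vanishes there
too (`IsChordDirection.bracket_eq_zero`). Equality forces `[e, X] = 0` along the whole half turn.

The Wigner caustic is `T`-periodic: after moving `X(a)` to the origin, `e = u'(a)` works for every
`a`. In case of equality the curve lies on a line parallel to `u'(a)` for each `a`, so it is a
point.

The constant width measure set is `T`-antiperiodic, and the choice of mean width gives `∫ [X, u'] =
0`. Hence `[X, u']` vanishes somewhere or changes sign at a vertex, and either event supplies a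
direction `e`. In case of equality `[X, u'] = 0` everywhere, which forces `X = 0`
(`eq_zero_of_bracket_D_eq_zero`).

Convexity enters as `[u'(r), u'(s)] ≥ 0` for `r ≤ s ≤ r + T`, proved from support functionals of the
norm. -/

theorem bracket_self (a : ℝ × ℝ) : bracket a a = 0 := by
  simp only [bracket]; ring

theorem bracket_swap (a b : ℝ × ℝ) : bracket a b = -bracket b a := by
  simp only [bracket]; ring

theorem bracket_add_left (a b c : ℝ × ℝ) : bracket (a + b) c = bracket a c + bracket b c := by
  simp only [bracket, Prod.fst_add, Prod.snd_add]; ring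

theorem bracket_add_right (a b c : ℝ × ℝ) : bracket a (b + c) = bracket a b + bracket a c := by
  simp only [bracket, Prod.fst_add, Prod.snd_add]; ring

theorem bracket_sub_left (a b c : ℝ × ℝ) : bracket (a - b) c = bracket a c - bracket b c := by
  simp only [bracket, Prod.fst_sub, Prod.snd_sub]; ring

theorem bracket_sub_right (a b c : ℝ × ℝ) : bracket a (b - c) = bracket a b - bracket a c := by
  simp only [bracket, Prod.fst_sub, Prod.snd_sub]; ring

theorem bracket_smul_left (k : ℝ) (a b : ℝ × ℝ) : bracket (k • a) b = k * bracket a b := by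
  simp only [bracket, Prod.smul_fst, Prod.smul_snd, smul_eq_mul]; ring

theorem bracket_smul_right (k : ℝ) (a b : ℝ × ℝ) : bracket a (k • b) = k * bracket a b := by
  simp only [bracket, Prod.smul_fst, Prod.smul_snd, smul_eq_mul]; ring

theorem bracket_neg_left (a b : ℝ × ℝ) : bracket (-a) b = -bracket a b := by
  simp only [bracket, Prod.fst_neg, Prod.snd_neg]; ring

theorem bracket_neg_right (a b : ℝ × ℝ) : bracket a (-b) = -bracket a b := by
  simp only [bracket, Prod.fst_neg, Prod.snd_neg]; ring

theorem bracket_zero_left (a : ℝ × ℝ) : bracket 0 a = 0 := by simp [bracket]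

theorem bracket_zero_right (a : ℝ × ℝ) : bracket a 0 = 0 := by simp [bracket]

/-- The Plücker relation. -/
theorem bracket_plucker (a b c d : ℝ × ℝ) :
    bracket a b * bracket c d - bracket a d * bracket c b = bracket a c * bracket b d := by
  simp only [bracket]; ring

/-- A vector with vanishing brackets with two independent vectors vanishes. -/
theorem eq_zero_of_bracket_eq_zero {x a b : ℝ × ℝ} (ha : bracket x a = 0) (hb : bracket x b = 0)
    (hab : bracket a b ≠ 0) : x = 0 := by
  have h1 : x.1 * bracket a b = 0 := by
    have : x.1 * bracket a b = a.1 * bracket x b - b.1 * bracket x a := by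
      simp only [bracket]; ring
    rw [this, ha, hb]; ring
  have h2 : x.2 * bracket a b = 0 := by
    have : x.2 * bracket a b = a.2 * bracket x b - b.2 * bracket x a := by
      simp only [bracket]; ring
    rw [this, ha, hb]; ring
  ext
  · exact (mul_eq_zero.mp h1).resolve_right hab
  · exact (mul_eq_zero.mp h2).resolve_right hab

/-- Two vectors with vanishing bracket are proportional. -/
theorem exists_smul_of_bracket_eq_zero {x a : ℝ × ℝ} (h : bracket a x = 0) (ha : a ≠ 0) :
    ∃ c : ℝ, x = c • a := by
  have h' : a.1 * x.2 = a.2 * x.1 := by simpa [bracket, sub_eq_zero] using h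
  by_cases h1 : a.1 = 0
  · have h2 : a.2 ≠ 0 := fun h2 => ha (Prod.ext h1 h2)
    refine ⟨x.2 / a.2, Prod.ext ?_ ?_⟩
    · have : x.1 = 0 := by
        have : a.2 * x.1 = 0 := by rw [← h', h1, zero_mul]
        exact (mul_eq_zero.mp this).resolve_left h2
      simp [this, h1]
    · simp [h2]
  · refine ⟨x.1 / a.1, Prod.ext ?_ ?_⟩
    · simp [h1]
    · simp only [Prod.smul_snd, smul_eq_mul]
      field_simp
      linarith

theorem ContinuousOn.bracket {f g : ℝ → ℝ × ℝ} {S : Set ℝ} (hf : ContinuousOn f S)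
    (hg : ContinuousOn g S) : ContinuousOn (fun s => _root_.bracket (f s) (g s)) S := by
  unfold _root_.bracket
  exact (hf.fst.mul hg.snd).sub (hf.snd.mul hg.fst)

theorem Continuous.bracket {f g : ℝ → ℝ × ℝ} (hf : Continuous f) (hg : Continuous g) :
    Continuous (fun s => _root_.bracket (f s) (g s)) := by
  unfold _root_.bracket
  fun_prop

theorem HasDerivWithinAt.bracket {f g : ℝ → ℝ × ℝ} {f' g' : ℝ × ℝ} {S : Set ℝ} {s : ℝ}
    (hf : HasDerivWithinAt f f' S s) (hg : HasDerivWithinAt g g' S s) :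
    HasDerivWithinAt (fun s => _root_.bracket (f s) (g s))
      (_root_.bracket f' (g s) + _root_.bracket (f s) g') S s := by
  have f1 : HasDerivWithinAt (fun x => (f x).1) f'.1 S s :=
    (ContinuousLinearMap.fst ℝ ℝ ℝ).hasFDerivAt.comp_hasDerivWithinAt s hf
  have f2 : HasDerivWithinAt (fun x => (f x).2) f'.2 S s :=
    (ContinuousLinearMap.snd ℝ ℝ ℝ).hasFDerivAt.comp_hasDerivWithinAt s hf
  have g1 : HasDerivWithinAt (fun x => (g x).1) g'.1 S s :=
    (ContinuousLinearMap.fst ℝ ℝ ℝ).hasFDerivAt.comp_hasDerivWithinAt s hg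
  have g2 : HasDerivWithinAt (fun x => (g x).2) g'.2 S s :=
    (ContinuousLinearMap.snd ℝ ℝ ℝ).hasFDerivAt.comp_hasDerivWithinAt s hg
  have := (f1.mul g2).sub (f2.mul g1)
  refine this.congr_deriv ?_
  simp only [_root_.bracket]; ring

theorem HasDerivAt.bracket {f g : ℝ → ℝ × ℝ} {f' g' : ℝ × ℝ} {s : ℝ}
    (hf : HasDerivAt f f' s) (hg : HasDerivAt g g' s) :
    HasDerivAt (fun s => _root_.bracket (f s) (g s))
      (_root_.bracket f' (g s) + _root_.bracket (f s) g') s := by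
  rw [← hasDerivWithinAt_univ] at *
  exact hf.bracket hg

/-- A continuous function on `[a, b]` that vanishes nowhere has constant sign. -/
theorem mul_pos_of_continuousOn_of_ne_zero {f : ℝ → ℝ} {S : Set ℝ} (hS : S.OrdConnected)
    (hf : ContinuousOn f S) (h0 : ∀ s ∈ S, f s ≠ 0) {x y : ℝ} (hx : x ∈ S) (hy : y ∈ S) :
    0 < f x * f y := by
  by_contra hneg
  have hlt : f x * f y < 0 :=
    lt_of_le_of_ne (not_lt.mp hneg) (mul_ne_zero (h0 x hx) (h0 y hy))
  have hpc : IsPreconnected (f '' S) := (isPreconnected_iff_ordConnected.mpr hS).image f hf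
  have hoc := isPreconnected_iff_ordConnected.mp hpc
  have : (0 : ℝ) ∈ f '' S := by
    rcases mul_neg_iff.mp hlt with ⟨h1, h2⟩ | ⟨h1, h2⟩
    · exact hoc.out (mem_image_of_mem f hy) (mem_image_of_mem f hx) ⟨h2.le, h1.le⟩
    · exact hoc.out (mem_image_of_mem f hx) (mem_image_of_mem f hy) ⟨h1.le, h2.le⟩
  obtain ⟨s, hs, h⟩ := this
  exact h0 s hs h

namespace SmoothByPartsPlane

variable (P : SmoothByPartsPlane)

/-! ### Division points and arcs -/

/-- The `i`-th closed parameter interval. -/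
abbrev arc (i : ℕ) : Set ℝ := Icc (P.t i) (P.t (i + 1))

theorem t_strictMono : StrictMono P.t := strictMono_nat_of_lt_succ P.t_lt

theorem t_nonneg (i : ℕ) : 0 ≤ P.t i := by
  rw [← P.t_zero]; exact P.t_strictMono.monotone (Nat.zero_le i)

theorem t_mul (k : ℕ) : P.t (k * P.n) = k * P.T := by
  induction k with
  | zero => simp [P.t_zero]
  | succ k ih => rw [Nat.succ_mul, P.t_add, ih]; push_cast; ring

theorem left_mem_arc (i : ℕ) : P.t i ∈ P.arc i := left_mem_Icc.mpr (P.t_lt i).le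

theorem right_mem_arc (i : ℕ) : P.t (i + 1) ∈ P.arc i := right_mem_Icc.mpr (P.t_lt i).le

theorem add_mem_arc {i : ℕ} {s : ℝ} (hs : s ∈ P.arc i) : s + P.T ∈ P.arc (i + P.n) := by
  refine ⟨?_, ?_⟩
  · rw [P.t_add]; linarith [hs.1]
  · rw [show i + P.n + 1 = i + 1 + P.n by ring, P.t_add]; linarith [hs.2]

theorem exists_mem_Ico {s : ℝ} (hs : 0 ≤ s) : ∃ i, s ∈ Ico (P.t i) (P.t (i + 1)) := by
  have hex : ∃ k, s < P.t k := by
    obtain ⟨k, hk⟩ := exists_nat_gt (s / P.T)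
    refine ⟨k * P.n, ?_⟩
    rw [P.t_mul]
    exact (div_lt_iff₀ P.T_pos).mp hk
  classical
  have h1 := Nat.find_spec hex
  have h0 : Nat.find hex ≠ 0 := by
    intro h
    rw [h, P.t_zero] at h1
    linarith
  obtain ⟨i, hi⟩ := Nat.exists_eq_succ_of_ne_zero h0
  refine ⟨i, not_lt.mp (Nat.find_min hex (by omega)), ?_⟩
  rw [hi] at h1
  exact h1

theorem le_of_mem_of_lt {i k : ℕ} {r s : ℝ} (hr : r ∈ P.arc i) (hs : s < P.t (k + 1))
    (hrs : r ≤ s) : i ≤ k := by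
  have : P.t i < P.t (k + 1) := lt_of_le_of_lt (hr.1.trans hrs) hs
  have := P.t_strictMono.lt_iff_lt.mp this
  omega

/-- A parameter between two arcs lies on an arc in between. -/
theorem exists_mem_arc {j l : ℕ} {a b s : ℝ} (hjl : j ≤ l) (ha : a ∈ P.arc j)
    (hb : b ∈ P.arc l)
    (hs : s ∈ Icc a b) : ∃ i, j ≤ i ∧ i ≤ l ∧ s ∈ P.arc i := by
  obtain ⟨i, hi⟩ := P.exists_mem_Ico ((P.t_nonneg j).trans (ha.1.trans hs.1))
  have hji : j ≤ i := P.le_of_mem_of_lt ha hi.2 hs.1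
  -- The half-open search overshoots to an arc beyond `l` only when `s` is the right end of arc `l`,
  -- and then `s = b`.
  by_cases hil : i ≤ l
  · exact ⟨i, hji, hil, hi.1, hi.2.le⟩
  · have h1 : P.t (l + 1) ≤ P.t i := P.t_strictMono.monotone (by omega)
    have h2 : s = P.t (l + 1) := le_antisymm (hs.2.trans hb.2) (h1.trans hi.1)
    have h3 : s = b := le_antisymm hs.2 (by rw [h2]; exact hb.2)
    exact ⟨l, hjl, le_rfl, h3 ▸ hb⟩

/-! ### Velocities -/

variable {P}

theorem hasDerivWithinAt_velocity {X : ℝ → ℝ × ℝ} {i : ℕ} (h : ContDiffOn ℝ ∞ X (P.arc i))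
    {s : ℝ} (hs : s ∈ P.arc i) : HasDerivWithinAt X (P.velocity X i s) (P.arc i) s :=
  (h.differentiableOn (by simp) s hs).hasDerivWithinAt

theorem hasDerivAt_velocity {X : ℝ → ℝ × ℝ} {i : ℕ} (h : ContDiffOn ℝ ∞ X (P.arc i))
    {s : ℝ} (hs : s ∈ Ioo (P.t i) (P.t (i + 1))) : HasDerivAt X (P.velocity X i s) s :=
  (hasDerivWithinAt_velocity h (Ioo_subset_Icc_self hs)).hasDerivAt (Icc_mem_nhds hs.1 hs.2)

variable (P) in
theorem velocity_eq {X : ℝ → ℝ × ℝ} {i : ℕ} {s : ℝ} {x : ℝ × ℝ} (hs : s ∈ P.arc i)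
    (h : HasDerivWithinAt X x (P.arc i) s) : P.velocity X i s = x :=
  h.derivWithin (uniqueDiffOn_Icc (P.t_lt i) s hs)

theorem contDiffOn_velocity {X : ℝ → ℝ × ℝ} {i : ℕ} (h : ContDiffOn ℝ ∞ X (P.arc i)) :
    ContDiffOn ℝ ∞ (P.velocity X i) (P.arc i) :=
  h.derivWithin (uniqueDiffOn_Icc (P.t_lt i)) (by simp)

theorem continuousOn_velocity {X : ℝ → ℝ × ℝ} {i : ℕ} (h : ContDiffOn ℝ ∞ X (P.arc i)) :
    ContinuousOn (P.velocity X i) (P.arc i) := (contDiffOn_velocity h).continuousOn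

variable (P) in
theorem velocity_comp_add (X : ℝ → ℝ × ℝ) (i : ℕ) (s : ℝ) :
    P.velocity (fun s => X (s + P.T)) i s = P.velocity X (i + P.n) (s + P.T) := by
  unfold velocity arcDeriv
  rw [derivWithin_comp_add_const]
  congr 1
  have : i + P.n + 1 = i + 1 + P.n := by ring
  rw [this, P.t_add, P.t_add, ← image_vadd]
  simp [add_comm]

end SmoothByPartsPlane

namespace SmoothByPartsPlane

variable (P : SmoothByPartsPlane)

/-! ### Geometry of the unit circle -/

/-- The velocity of the unit circle along the `i`-th arc. -/
noncomputable abbrev D (i : ℕ) (s : ℝ) : ℝ × ℝ := P.velocity P.u i s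

theorem bracket_u_D_pos {i : ℕ} {s : ℝ} (hs : s ∈ P.arc i) : 0 < bracket (P.u s) (P.D i s) :=
  P.u_counterclockwise i s hs

theorem D_ne_zero {i : ℕ} {s : ℝ} (hs : s ∈ P.arc i) : P.D i s ≠ 0 := P.u_regular i s hs

theorem D_add (i : ℕ) (s : ℝ) : P.D (i + P.n) (s + P.T) = -P.D i s := by
  rw [D, ← P.velocity_comp_add]
  have : (fun s => P.u (s + P.T)) = -P.u := by
    funext s; simp [P.u_antiperiodic]
  rw [this]
  simp only [D, velocity, arcDeriv]
  exact derivWithin.neg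

theorem u_add_two_mul (s : ℝ) : P.u (s + 2 * P.T) = P.u s := by
  rw [two_mul, ← add_assoc, P.u_antiperiodic, P.u_antiperiodic, neg_neg]

theorem u_periodic : Function.Periodic P.u (2 * P.T) := P.u_add_two_mul

theorem two_T_pos : 0 < 2 * P.T := by linarith [P.T_pos]

theorem norm_u (s : ℝ) : P.norm (P.u s) = 1 := by
  obtain ⟨r, hr, h⟩ := P.u_periodic.exists_mem_Ico₀ P.two_T_pos s
  have : P.u r ∈ {x | P.norm x = 1} :=
    P.u_image ▸ mem_image_of_mem _ (Ico_subset_Icc_self hr)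
  rw [h]; exact this

/-- Parameters of the same point differ by a multiple of the period. -/
theorem exists_int_of_u_eq {r s : ℝ} (h : P.u r = P.u s) : ∃ k : ℤ, r - s = k * (2 * P.T) := by
  obtain ⟨k, hk⟩ : ∃ k : ℤ, toIcoMod P.two_T_pos 0 r = r - k • (2 * P.T) := ⟨_, rfl⟩
  obtain ⟨l, hl⟩ : ∃ l : ℤ, toIcoMod P.two_T_pos 0 s = s - l • (2 * P.T) := ⟨_, rfl⟩
  have h1 := toIcoMod_mem_Ico' P.two_T_pos r
  have h2 := toIcoMod_mem_Ico' P.two_T_pos s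
  have h3 : toIcoMod P.two_T_pos 0 r = toIcoMod P.two_T_pos 0 s := by
    refine P.u_injOn h1 h2 ?_
    rw [hk, hl, P.u_periodic.sub_zsmul_eq, P.u_periodic.sub_zsmul_eq, h]
  refine ⟨k - l, ?_⟩
  rw [hk, hl] at h3
  simp only [zsmul_eq_mul] at h3
  push_cast
  linarith

/-- A support functional of the unit ball at a point of the unit circle. -/
theorem exists_support (s : ℝ) : ∃ g : ℝ × ℝ →ₗ[ℝ] ℝ, g (P.u s) = 1 ∧ ∀ x, g x ≤ P.norm x := by
  have hu : P.u s ≠ 0 := by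
    intro h
    have := P.norm_u s
    rw [h, map_zero] at this
    exact zero_ne_one this
  obtain ⟨g, hg, hN⟩ := exists_extension_of_le_sublinear
    (LinearPMap.mkSpanSingleton (P.u s) (1 : ℝ) hu) P.norm
    (fun c hc x => by rw [map_smul_eq_mul, Real.norm_of_nonneg hc.le])
    (fun x y => map_add_le_add P.norm x y)
    (by
      rintro ⟨x, hx⟩
      obtain ⟨c, rfl⟩ := Submodule.mem_span_singleton.mp
        (show x ∈ Submodule.span ℝ {P.u s} from hx)
      have := LinearPMap.mkSpanSingleton'_apply (σ := RingHom.id ℝ) (P.u s) (1 : ℝ)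
        (fun c hc => by
          rw [(smul_eq_zero.mp hc).resolve_right hu]; simp) c hx
      refine this.le.trans ?_
      show (RingHom.id ℝ) c • (1 : ℝ) ≤ P.norm (c • P.u s)
      rw [map_smul_eq_mul, P.norm_u]
      simpa using le_abs_self c)
  refine ⟨g, ?_, hN⟩
  have := hg ⟨P.u s, Submodule.mem_span_singleton_self _⟩
  exact this.trans (LinearPMap.mkSpanSingleton_apply ℝ ℝ hu (1 : ℝ))

/-- The tangent lines of the unit circle support the unit ball. -/
theorem bracket_D_le {i : ℕ} {s : ℝ} (hs : s ∈ P.arc i) (x : ℝ × ℝ) :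
    bracket x (P.D i s) ≤ P.norm x * bracket (P.u s) (P.D i s) := by
  have hcD : ContinuousOn (P.D i) (P.arc i) := continuousOn_velocity (P.u_smooth i)
  have hcl : closure (Ioo (P.t i) (P.t (i + 1))) = P.arc i := closure_Ioo (P.t_lt i).ne
  -- Inside the arc `u` is differentiable on both sides, so Fermat's criterion applies to `g ∘ u`;
  -- the end points follow by continuity.
  refine le_on_closure (s := Ioo (P.t i) (P.t (i + 1)))
    (f := fun s => bracket x (P.D i s)) (g := fun s => P.norm x * bracket (P.u s) (P.D i s))
    ?_ ?_ ?_ (hcl ▸ hs)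
  · intro s hs
    obtain ⟨g, hg, hN⟩ := P.exists_support s
    have hd : HasDerivAt (fun r => g (P.u r)) (g (P.D i s)) s :=
      (LinearMap.toContinuousLinearMap g).hasFDerivAt.comp_hasDerivAt s
        (hasDerivAt_velocity (P.u_smooth i) hs)
    have hmax : IsLocalMax (fun r => g (P.u r)) s :=
      Filter.Eventually.of_forall fun r => by
        show g (P.u r) ≤ g (P.u s)
        rw [hg, ← P.norm_u r]; exact hN _
    have h0 : g (P.D i s) = 0 := hmax.hasDerivAt_eq_zero hd
    have key : bracket x (P.D i s) = g x * bracket (P.u s) (P.D i s) := by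
      -- Cramer's rule in the basis `u, u'`; applying `g` kills the tangential component.
      have e : bracket (P.u s) (P.D i s) • x =
          bracket x (P.D i s) • P.u s + bracket (P.u s) x • P.D i s := by
        ext <;> simp only [bracket, Prod.smul_fst, Prod.smul_snd, Prod.fst_add, Prod.snd_add,
          smul_eq_mul] <;> ring
      have := congrArg g e
      simp only [map_add, map_smul, smul_eq_mul, h0, hg] at this
      linarith
    show bracket x (P.D i s) ≤ _
    rw [key]
    exact mul_le_mul_of_nonneg_right (hN x) (P.bracket_u_D_pos (Ioo_subset_Icc_self hs)).le
  · rw [hcl]; exact continuousOn_const.bracket hcD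
  · rw [hcl]; exact continuousOn_const.mul (P.u_continuous.continuousOn.bracket hcD)

theorem abs_bracket_u_D_le {i : ℕ} {s : ℝ} (hs : s ∈ P.arc i) (r : ℝ) :
    |bracket (P.u r) (P.D i s)| ≤ bracket (P.u s) (P.D i s) := by
  rw [abs_le]
  constructor
  · have := P.bracket_D_le hs (-P.u r)
    rw [map_neg_eq_map, P.norm_u, bracket_neg_left] at this
    linarith
  · have := P.bracket_D_le hs (P.u r)
    rwa [P.norm_u, one_mul] at this

/-- Parallel unit vectors are equal or opposite, so `s - r` would be a multiple of `T`. -/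
theorem bracket_u_ne_zero {r s : ℝ} (h1 : r < s) (h2 : s < r + P.T) :
    bracket (P.u r) (P.u s) ≠ 0 := by
  intro h
  have hu : P.u r ≠ 0 := by
    intro h
    have := P.norm_u r
    rw [h, map_zero] at this
    exact zero_ne_one this
  obtain ⟨c, hc⟩ := exists_smul_of_bracket_eq_zero h hu
  have hn := congrArg P.norm hc
  rw [map_smul_eq_mul, P.norm_u, P.norm_u, mul_one, Real.norm_eq_abs] at hn
  have hT := P.T_pos
  rcases (abs_eq zero_le_one).mp hn.symm with rfl | rfl
  · rw [one_smul] at hc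
    obtain ⟨k, hk⟩ := P.exists_int_of_u_eq hc
    have h3 : (0 : ℝ) < k := by
      by_contra h3
      nlinarith [not_lt.mp h3]
    have h4 : (1 : ℝ) ≤ k := by exact_mod_cast h3
    nlinarith
  · rw [neg_one_smul, ← P.u_antiperiodic] at hc
    obtain ⟨k, hk⟩ := P.exists_int_of_u_eq hc
    have h3 : (k : ℝ) < 0 := by
      by_contra h3
      nlinarith [not_lt.mp h3]
    have h5 : k < 0 := by exact_mod_cast h3
    have h4 : (k : ℝ) ≤ -1 := by exact_mod_cast (show k ≤ -1 by omega)
    nlinarith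

/-- The bracket is positive just after `r`, since its right derivative there is `[u(r), u'(r)] > 0`,
and it has no zero before `r + T`. -/
theorem bracket_u_pos {r s : ℝ} (h0 : 0 ≤ r) (h1 : r < s) (h2 : s < r + P.T) :
    0 < bracket (P.u r) (P.u s) := by
  obtain ⟨i, hi⟩ := P.exists_mem_Ico h0
  have hri : r ∈ P.arc i := Ico_subset_Icc_self hi
  have hd : HasDerivWithinAt (fun s => bracket (P.u r) (P.u s))
      (bracket (P.u r) (P.D i r)) (Ioi r) r := by
    have := ((hasDerivWithinAt_const r (P.arc i) (P.u r)).bracket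
      (hasDerivWithinAt_velocity (P.u_smooth i) hri))
    rw [bracket_zero_left, zero_add] at this
    exact this.mono_of_mem_nhdsWithin
      (mem_nhdsWithin_of_mem_nhds (Iio_mem_nhds hi.2) |> fun h => by
        filter_upwards [h, self_mem_nhdsWithin] with x hx hx'
        exact ⟨hi.1.trans (le_of_lt hx'), le_of_lt hx⟩)
  have hlim := (hasDerivWithinAt_iff_tendsto_slope' (by simp)).mp hd
  have hev := hlim.eventually (lt_mem_nhds (P.bracket_u_D_pos hri))
  have hnear : ∀ᶠ x in nhdsWithin r (Ioi r), x < r + P.T :=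
    mem_nhdsWithin_of_mem_nhds (Iio_mem_nhds (h1.trans h2))
  obtain ⟨x, hx1, hx2, hx3⟩ := (hev.and (hnear.and
      (eventually_mem_nhdsWithin (a := r) (s := Ioi r)))).exists
  have hxp : 0 < bracket (P.u r) (P.u x) := by
    rw [slope_def_field, bracket_self, sub_zero] at hx1
    exact (div_pos_iff_of_pos_right (sub_pos.mpr hx3)).mp hx1
  have := mul_pos_of_continuousOn_of_ne_zero (S := Ioo r (r + P.T)) ordConnected_Ioo
    (f := fun s => bracket (P.u r) (P.u s))
    ((continuous_const.bracket P.u_continuous).continuousOn)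
    (fun s hs => P.bracket_u_ne_zero hs.1 hs.2) ⟨hx3, hx2⟩ ⟨h1, h2⟩
  exact (mul_pos_iff_of_pos_left hxp).mp this

/-- The tangent direction of the unit circle turns counterclockwise. -/
theorem bracket_D_nonneg_of_lt {i k : ℕ} {r s : ℝ} (hr : r ∈ P.arc i) (hs : s ∈ P.arc k)
    (h1 : r < s) (h2 : s < r + P.T) : 0 ≤ bracket (P.D i r) (P.D k s) := by
  have hd := P.bracket_u_pos ((P.t_nonneg i).trans hr.1) h1 h2
  have ha := P.bracket_u_D_pos hr
  have hb := P.bracket_u_D_pos hs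
  have h3 := P.abs_bracket_u_D_le hr s
  have h4 := P.abs_bracket_u_D_le hs r
  -- The Plücker relation writes `[u(r), u(s)] [u'(r), u'(s)]` as a difference that the two support
  -- inequalities make nonnegative.
  have key := bracket_plucker (P.u r) (P.D i r) (P.u s) (P.D k s)
  have h5 : bracket (P.u r) (P.D k s) * bracket (P.u s) (P.D i r) ≤
      bracket (P.u r) (P.D i r) * bracket (P.u s) (P.D k s) := by
    calc _ ≤ |bracket (P.u r) (P.D k s) * bracket (P.u s) (P.D i r)| := le_abs_self _
      _ = |bracket (P.u s) (P.D i r)| * |bracket (P.u r) (P.D k s)| := by rw [abs_mul, mul_comm]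
      _ ≤ _ := mul_le_mul h3 h4 (abs_nonneg _) ha.le
  have h6 : 0 ≤ bracket (P.u r) (P.u s) * bracket (P.D i r) (P.D k s) := by linarith
  exact nonneg_of_mul_nonneg_right h6 hd

/-- The limiting cases `r = s` and `s = r + T` on different arcs compare the one-sided tangents at a
vertex. They follow by continuity once both parameters are moved slightly into their arcs. -/
theorem bracket_D_nonneg {i k : ℕ} {r s : ℝ} (hr : r ∈ P.arc i) (hs : s ∈ P.arc k)
    (hik : i ≤ k) (hki : k ≤ i + P.n) (h1 : r ≤ s) (h2 : s ≤ r + P.T) :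
    0 ≤ bracket (P.D i r) (P.D k s) := by
  by_cases hc1 : i = k ∧ r = s
  · obtain ⟨rfl, rfl⟩ := hc1
    rw [bracket_self]
  by_cases hc2 : k = i + P.n ∧ s = r + P.T
  · obtain ⟨rfl, rfl⟩ := hc2
    rw [P.D_add, bracket_neg_right, bracket_self, neg_zero]
  -- Moving each parameter towards the midpoint of its arc makes both inequalities strict, because
  -- midpoints increase strictly with the index and shift by `T` with `n`.
  set c : ℕ → ℝ := fun i => (P.t i + P.t (i + 1)) / 2 with hc
  have hcmono : StrictMono c := fun a b hab => by
    have h1 := P.t_strictMono hab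
    have h2 := P.t_strictMono (Nat.succ_lt_succ hab)
    simp only [hc, Nat.succ_eq_add_one] at h2 ⊢
    linarith
  have hcn : c (i + P.n) = c i + P.T := by
    simp only [hc]
    rw [show i + P.n + 1 = i + 1 + P.n by ring, P.t_add, P.t_add]; ring
  have hmem : ∀ i, ∀ r ∈ P.arc i, ∀ ε ∈ Icc (0 : ℝ) 1, r + ε * (c i - r) ∈ P.arc i := by
    intro i r hr ε hε
    have := P.t_lt i
    constructor <;> simp only [hc] <;> nlinarith [hr.1, hr.2, hε.1, hε.2]
  have hlt1 : ∀ ε ∈ Ioo (0 : ℝ) 1, r + ε * (c i - r) < s + ε * (c k - s) := by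
    intro ε hε
    rcases h1.lt_or_eq with h | h
    · have := hcmono.monotone hik
      nlinarith [hε.1, hε.2, mul_nonneg hε.1.le (sub_nonneg.mpr this),
        mul_pos (sub_pos.mpr hε.2) (sub_pos.mpr h)]
    · have : c i < c k := hcmono (lt_of_le_of_ne hik fun h' => hc1 ⟨h', h⟩)
      subst h
      nlinarith [mul_pos hε.1 (sub_pos.mpr this)]
  have hlt2 : ∀ ε ∈ Ioo (0 : ℝ) 1, s + ε * (c k - s) < r + ε * (c i - r) + P.T := by
    intro ε hε
    rcases h2.lt_or_eq with h | h
    · have := hcmono.monotone hki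
      rw [hcn] at this
      nlinarith [hε.1, hε.2, mul_nonneg hε.1.le (sub_nonneg.mpr this),
        mul_pos (sub_pos.mpr hε.2) (sub_pos.mpr h)]
    · have : c k < c i + P.T := by
        rw [← hcn]; exact hcmono (lt_of_le_of_ne hki fun h' => hc2 ⟨h', h⟩)
      subst h
      nlinarith [mul_pos hε.1 (sub_pos.mpr this)]
  have hcont : ContinuousOn (fun ε : ℝ => bracket (P.D i (r + ε * (c i - r)))
      (P.D k (s + ε * (c k - s)))) (Icc 0 1) :=
    ((continuousOn_velocity (P.u_smooth i)).comp (by fun_prop) (hmem i r hr)).bracket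
      ((continuousOn_velocity (P.u_smooth k)).comp (by fun_prop) (hmem k s hs))
  have hcl : closure (Ioo (0 : ℝ) 1) = Icc 0 1 := closure_Ioo zero_ne_one
  have := le_on_closure (s := Ioo (0 : ℝ) 1) (f := fun _ => (0 : ℝ))
    (g := fun ε : ℝ => bracket (P.D i (r + ε * (c i - r))) (P.D k (s + ε * (c k - s))))
    (fun ε hε => P.bracket_D_nonneg_of_lt (hmem i r hr ε (Ioo_subset_Icc_self hε))
      (hmem k s hs ε (Ioo_subset_Icc_self hε)) (hlt1 ε hε) (hlt2 ε hε))
    continuousOn_const (hcl ▸ hcont) (x := 0) (by rw [hcl]; simp)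
  simpa using this

/-- The second one-sided derivative of the unit circle. -/
noncomputable abbrev D2 (i : ℕ) (s : ℝ) : ℝ × ℝ := P.velocity (P.D i) i s

theorem hasDerivWithinAt_D {i : ℕ} {s : ℝ} (hs : s ∈ P.arc i) :
    HasDerivWithinAt (P.D i) (P.D2 i s) (P.arc i) s :=
  hasDerivWithinAt_velocity (contDiffOn_velocity (P.u_smooth i)) hs

theorem hasDerivWithinAt_u {i : ℕ} {s : ℝ} (hs : s ∈ P.arc i) :
    HasDerivWithinAt P.u (P.D i s) (P.arc i) s :=
  hasDerivWithinAt_velocity (P.u_smooth i) hs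

theorem continuousOn_D (i : ℕ) : ContinuousOn (P.D i) (P.arc i) :=
  continuousOn_velocity (P.u_smooth i)

/-- The limit of `[u'(s), u'(x)] / (x - s)` as `x` decreases to `s`. -/
theorem bracket_D_D2_nonneg {i : ℕ} {s : ℝ} (hs : s ∈ Ioo (P.t i) (P.t (i + 1))) :
    0 ≤ bracket (P.D i s) (P.D2 i s) := by
  have hsi := Ioo_subset_Icc_self hs
  have hd : HasDerivWithinAt (fun r => bracket (P.D i s) (P.D i r))
      (bracket (P.D i s) (P.D2 i s)) (Ioi s) s := by
    have := (hasDerivWithinAt_const s (P.arc i) (P.D i s)).bracket (P.hasDerivWithinAt_D hsi)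
    rw [bracket_zero_left, zero_add] at this
    exact (this.hasDerivAt (Icc_mem_nhds hs.1 hs.2)).hasDerivWithinAt
  have hlim := (hasDerivWithinAt_iff_tendsto_slope' (by simp)).mp hd
  refine ge_of_tendsto hlim ?_
  have h2 : P.t (i + 1) ≤ P.t i + P.T := by
    rw [← P.t_add]; exact P.t_strictMono.monotone (by have := P.n_pos; omega)
  filter_upwards [mem_nhdsWithin_of_mem_nhds (Iio_mem_nhds hs.2), self_mem_nhdsWithin]
    with x hx1 hx2
  rw [slope_def_field, bracket_self, sub_zero]
  refine div_nonneg ?_ (sub_pos.mpr hx2).le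
  have hx1' : x < P.t (i + 1) := hx1
  have hx2' : s < x := hx2
  exact P.bracket_D_nonneg_of_lt hsi ⟨hs.1.le.trans hx2'.le, hx1'.le⟩ hx2'
    (by linarith [hs.1])

/-! ### Straight arcs -/

theorem straight_endpoints_ne {i : ℕ} (h : IsStraightArc P.u (P.t i) (P.t (i + 1))) :
    P.u (P.t (i + 1)) - P.u (P.t i) ≠ 0 := by
  intro h0
  have h1 : ∀ s ∈ P.arc i, P.u s = P.u (P.t i) := by
    intro s hs
    have : P.u s ∈ segment ℝ (P.u (P.t i)) (P.u (P.t (i + 1))) := h ▸ mem_image_of_mem _ hs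
    rw [sub_eq_zero.mp h0, segment_same] at this
    exact this
  refine P.D_ne_zero (P.left_mem_arc i) (P.velocity_eq (P.left_mem_arc i) ?_)
  exact (hasDerivWithinAt_const _ _ (P.u (P.t i))).congr h1 (h1 _ (P.left_mem_arc i))

/-- With `d` the chord, `[d, u]` is constant on the arc, so `[d, u'] = 0`; regularity excludes `c =
0`. -/
theorem straight_exists_smul {i : ℕ} (h : IsStraightArc P.u (P.t i) (P.t (i + 1))) {s : ℝ}
    (hs : s ∈ P.arc i) :
    ∃ c : ℝ, c ≠ 0 ∧ P.D i s = c • (P.u (P.t (i + 1)) - P.u (P.t i)) := by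
  set d := P.u (P.t (i + 1)) - P.u (P.t i) with hd
  have h1 : ∀ s ∈ P.arc i, bracket d (P.u s) = bracket d (P.u (P.t i)) := by
    intro s hs
    have : P.u s ∈ segment ℝ (P.u (P.t i)) (P.u (P.t (i + 1))) := h ▸ mem_image_of_mem _ hs
    rw [segment_eq_image'] at this
    obtain ⟨θ, -, hθ⟩ := this
    rw [← hθ]
    simp only [bracket_add_right, bracket_smul_right, ← hd, bracket_self, mul_zero, add_zero]
  have h2 := (hasDerivWithinAt_const s (P.arc i) d).bracket (P.hasDerivWithinAt_u hs)
  have h3 := (hasDerivWithinAt_const s (P.arc i) (bracket d (P.u (P.t i)))).congr h1 (h1 s hs)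
  have h4 := (uniqueDiffOn_Icc (P.t_lt i) s hs).eq_deriv _ h2 h3
  rw [bracket_zero_left, zero_add] at h4
  obtain ⟨c, hc⟩ := exists_smul_of_bracket_eq_zero h4 (P.straight_endpoints_ne h)
  refine ⟨c, ?_, hc⟩
  rintro rfl
  exact P.D_ne_zero hs (by rw [hc, zero_smul])

theorem straight_exists_smul' {i : ℕ} (h : IsStraightArc P.u (P.t i) (P.t (i + 1))) {r s : ℝ}
    (hr : r ∈ P.arc i) (hs : s ∈ P.arc i) : ∃ c : ℝ, P.D i s = c • P.D i r := by
  obtain ⟨c, hc, h1⟩ := P.straight_exists_smul h hr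
  obtain ⟨d, hd, h2⟩ := P.straight_exists_smul h hs
  refine ⟨d * c⁻¹, ?_⟩
  rw [h1, h2, smul_smul, mul_assoc, inv_mul_cancel₀ hc, mul_one]

theorem straight_vertex {i : ℕ} (h : IsStraightArc P.u (P.t i) (P.t (i + 1)))
    (h' : IsStraightArc P.u (P.t (i + 1)) (P.t (i + 2))) :
    bracket (P.D i (P.t (i + 1))) (P.D (i + 1) (P.t (i + 1))) ≠ 0 := by
  obtain ⟨c, hc, h1⟩ := P.straight_exists_smul h (P.right_mem_arc i)
  obtain ⟨d, hd, h2⟩ := P.straight_exists_smul h' (P.left_mem_arc (i + 1))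
  rw [h1, h2, bracket_smul_left, bracket_smul_right]
  exact mul_ne_zero hc (mul_ne_zero hd (P.vertex i h h'))

end SmoothByPartsPlane

namespace SmoothByPartsPlane

variable {P : SmoothByPartsPlane} {X Y : ℝ → ℝ × ℝ}

/-! ### The space of admissible curves -/

theorem straight_add {i : ℕ} (h : IsStraightArc P.u (P.t i) (P.t (i + 1))) :
    IsStraightArc P.u (P.t (i + P.n)) (P.t (i + P.n + 1)) := by
  have hu : P.u ∘ (fun s => s + P.T) = Neg.neg ∘ P.u := funext P.u_antiperiodic
  have hneg : (Neg.neg : ℝ × ℝ → ℝ × ℝ) = ⇑(-LinearMap.id : ℝ × ℝ →ₗ[ℝ] ℝ × ℝ).toAffineMap := rfl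
  unfold IsStraightArc at *
  rw [show i + P.n + 1 = i + 1 + P.n by ring, P.t_add, P.t_add, P.u_antiperiodic,
    P.u_antiperiodic, ← image_add_const_Icc, ← image_comp, hu, image_comp, h, hneg,
    image_segment]

namespace IsAdmissible

theorem hasDerivWithinAt (hX : P.IsAdmissible X) {i : ℕ} {s : ℝ} (hs : s ∈ P.arc i) :
    HasDerivWithinAt X (P.velocity X i s) (P.arc i) s :=
  hasDerivWithinAt_velocity (hX.smooth i) hs

theorem hasDerivAt (hX : P.IsAdmissible X) {i : ℕ} {s : ℝ}
    (hs : s ∈ Ioo (P.t i) (P.t (i + 1))) : HasDerivAt X (P.velocity X i s) s :=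
  hasDerivAt_velocity (hX.smooth i) hs

theorem deriv_eq (hX : P.IsAdmissible X) {i : ℕ} {s : ℝ}
    (hs : s ∈ Ioo (P.t i) (P.t (i + 1))) : deriv X s = P.velocity X i s := (hX.hasDerivAt hs).deriv

theorem add (hX : P.IsAdmissible X) (hY : P.IsAdmissible Y) :
    P.IsAdmissible (fun s => X s + Y s) where
  continuous := hX.continuous.add hY.continuous
  periodic s := by rw [hX.periodic, hY.periodic]
  smooth i := (hX.smooth i).add (hY.smooth i)
  exists_radius i := by
    obtain ⟨r, hr, hr'⟩ := hX.exists_radius i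
    obtain ⟨q, hq, hq'⟩ := hY.exists_radius i
    refine ⟨fun s => r s + q s, fun s hs => ?_, fun h => ?_⟩
    · refine (P.velocity_eq hs ((hX.hasDerivWithinAt hs).add (hY.hasDerivWithinAt hs))).trans ?_
      rw [hr s hs, hq s hs, add_smul]
    · obtain ⟨k, hk⟩ := hr' h
      obtain ⟨l, hl⟩ := hq' h
      exact ⟨k + l, fun s hs => by simp only [hk s hs, hl s hs]⟩

theorem smul (c : ℝ) (hX : P.IsAdmissible X) : P.IsAdmissible (fun s => c • X s) where
  continuous := hX.continuous.const_smul c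
  periodic s := by rw [hX.periodic]
  smooth i := (hX.smooth i).const_smul c
  exists_radius i := by
    obtain ⟨r, hr, hr'⟩ := hX.exists_radius i
    refine ⟨fun s => c * r s, fun s hs => ?_, fun h => ?_⟩
    · refine (P.velocity_eq hs ((hX.hasDerivWithinAt hs).const_smul c)).trans ?_
      rw [hr s hs, mul_smul]
    · obtain ⟨k, hk⟩ := hr' h
      exact ⟨c * k, fun s hs => by simp only [hk s hs]⟩

theorem const (P : SmoothByPartsPlane) (p : ℝ × ℝ) : P.IsAdmissible (fun _ => p) where
  continuous := continuous_const
  periodic _ := rfl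
  smooth _ := contDiffOn_const
  exists_radius i := ⟨fun _ => 0, fun s hs => by
    rw [P.velocity_eq hs (hasDerivWithinAt_const s _ p), zero_smul], fun _ => ⟨0, fun _ _ => rfl⟩⟩

theorem sub (hX : P.IsAdmissible X) (hY : P.IsAdmissible Y) :
    P.IsAdmissible (fun s => X s - Y s) := by
  have := hX.add (hY.smul (-1))
  simpa only [neg_one_smul, ← sub_eq_add_neg] using this

theorem comp_add (hX : P.IsAdmissible X) : P.IsAdmissible (fun s => X (s + P.T)) where
  continuous := hX.continuous.comp (continuous_id.add continuous_const)
  periodic s := by rw [show s + 2 * P.T + P.T = s + P.T + 2 * P.T by ring, hX.periodic]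
  smooth i := (hX.smooth (i + P.n)).comp (contDiff_id.add contDiff_const).contDiffOn
    fun s hs => P.add_mem_arc hs
  exists_radius i := by
    obtain ⟨r, hr, hr'⟩ := hX.exists_radius (i + P.n)
    -- The sign appears because `u'` changes sign under a half turn.
    refine ⟨fun s => -r (s + P.T), fun s hs => ?_, fun h => ?_⟩
    · rw [P.velocity_comp_add, hr _ (P.add_mem_arc hs)]
      show _ • P.D (i + P.n) (s + P.T) = _
      rw [P.D_add, smul_neg, neg_smul]
    · obtain ⟨k, hk⟩ := hr' (straight_add h)
      exact ⟨-k, fun s hs => by simp only [hk _ (P.add_mem_arc hs)]⟩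

theorem u (P : SmoothByPartsPlane) : P.IsAdmissible P.u where
  continuous := P.u_continuous
  periodic := P.u_add_two_mul
  smooth := P.u_smooth
  exists_radius i := ⟨fun _ => 1, fun s _ => by rw [one_smul], fun _ => ⟨1, fun _ _ => rfl⟩⟩

end IsAdmissible

variable (P) in
/-- A function with vanishing derivative off the division points is constant. -/
theorem eq_of_hasDerivAt_zero {E : Type*} [NormedAddCommGroup E] [NormedSpace ℝ E]
    [CompleteSpace E] {f : ℝ → E} {a b : ℝ} (ha : 0 ≤ a) (hab : a ≤ b)
    (hf : ContinuousOn f (Icc a b))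
    (hd : ∀ i, ∀ s ∈ Ioo (P.t i) (P.t (i + 1)), s ∈ Ioo a b → HasDerivAt f 0 s) : f b = f a := by
  have := MeasureTheory.integral_eq_of_hasDerivAt_off_countable f (fun _ => (0 : E)) (a := a)
    (b := b) (countable_range P.t) (by rwa [uIcc_of_le hab]) ?_ (by simp)
  · rw [intervalIntegral.integral_zero] at this
    exact (sub_eq_zero.mp this.symm)
  · rintro s ⟨hs, hst⟩
    rw [min_eq_left hab, max_eq_right hab] at hs
    obtain ⟨i, hi⟩ := P.exists_mem_Ico (ha.trans hs.1.le)
    exact hd i s ⟨lt_of_le_of_ne hi.1 fun h => hst ⟨i, h⟩, hi.2⟩ hs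

/-! ### Mixed area integrals -/

/-- Inside each arc `deriv Y` agrees with the one-sided velocity, which is continuous up to the
ends; finitely many arcs cover the interval. -/
theorem intervalIntegrable_bracket_deriv (hX : P.IsAdmissible X) (hY : P.IsAdmissible Y)
    {a b : ℝ} (ha : 0 ≤ a) (hb : 0 ≤ b) :
    IntervalIntegrable (fun s => bracket (X s) (deriv Y s)) MeasureTheory.volume a b := by
  have key : ∀ b, 0 ≤ b →
      IntervalIntegrable (fun s => bracket (X s) (deriv Y s)) MeasureTheory.volume 0 b := by
    intro b hb
    obtain ⟨k, hk⟩ := P.exists_mem_Ico hb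
    have h1 : IntervalIntegrable (fun s => bracket (X s) (deriv Y s)) MeasureTheory.volume
        (P.t 0) (P.t (k + 1)) := by
      refine IntervalIntegrable.trans_iterate fun i _ => ?_
      refine IntervalIntegrable.congr_uIoo
        (f := fun s => bracket (X s) (P.velocity Y i s)) ?_ ?_
      · refine ContinuousOn.intervalIntegrable ?_
        rw [uIcc_of_le (P.t_lt i).le]
        exact hX.continuous.continuousOn.bracket (continuousOn_velocity (hY.smooth i))
      · rw [uIoo_of_le (P.t_lt i).le]
        intro s hs
        simp only [hY.deriv_eq hs]
    refine h1.mono_set ?_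
    rw [P.t_zero, uIcc_of_le hb, uIcc_of_le (P.t_nonneg _)]
    exact Icc_subset_Icc_right hk.2.le
  exact (key a ha).symm.trans (key b hb)

variable (P) in
/-- The primitive of `[X, Y']`. -/
noncomputable def primitive (X Y : ℝ → ℝ × ℝ) (s : ℝ) : ℝ :=
  ∫ r in (0 : ℝ)..s, bracket (X r) (deriv Y r)

theorem integral_eq_primitive_sub (hX : P.IsAdmissible X) (hY : P.IsAdmissible Y)
    {a b : ℝ} (ha : 0 ≤ a) (hb : 0 ≤ b) :
    ∫ s in a..b, bracket (X s) (deriv Y s) = primitive X Y b - primitive X Y a := by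
  unfold primitive
  rw [intervalIntegral.integral_interval_sub_left
    (intervalIntegrable_bracket_deriv hX hY le_rfl hb)
    (intervalIntegrable_bracket_deriv hX hY le_rfl ha)]

theorem continuousOn_primitive (hX : P.IsAdmissible X) (hY : P.IsAdmissible Y) {a b : ℝ}
    (ha : 0 ≤ a) : ContinuousOn (primitive X Y) (Icc a b) := by
  by_cases hb : 0 ≤ b
  · have := intervalIntegral.continuousOn_primitive_interval (μ := MeasureTheory.volume)
      (f := fun s => bracket (X s) (deriv Y s)) (a := 0) (b := b)
      (by
        have := intervalIntegrable_bracket_deriv hX hY le_rfl hb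
        rwa [intervalIntegrable_iff', uIcc_of_le hb] at *)
    rw [uIcc_of_le hb] at this
    exact this.mono (Icc_subset_Icc_left ha)
  · rw [Icc_eq_empty (by intro h; exact hb (ha.trans h))]
    exact continuousOn_empty _

theorem hasDerivAt_primitive (hX : P.IsAdmissible X) (hY : P.IsAdmissible Y) {i : ℕ} {s : ℝ}
    (hs : s ∈ Ioo (P.t i) (P.t (i + 1))) :
    HasDerivAt (primitive X Y) (bracket (X s) (P.velocity Y i s)) s := by
  have hev : (fun r => bracket (X r) (P.velocity Y i r)) =ᶠ[nhds s]
      fun r => bracket (X r) (deriv Y r) := by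
    filter_upwards [Ioo_mem_nhds hs.1 hs.2] with r hr
    rw [hY.deriv_eq hr]
  have hc : ContinuousOn (fun r => bracket (X r) (P.velocity Y i r)) (P.arc i) :=
    hX.continuous.continuousOn.bracket (continuousOn_velocity (hY.smooth i))
  rw [← hY.deriv_eq hs]
  refine intervalIntegral.integral_hasDerivAt_right (f := fun s => bracket (X s) (deriv Y s))
    (intervalIntegrable_bracket_deriv hX hY le_rfl ((P.t_nonneg i).trans hs.1.le)) ?_
    ((hc.continuousAt (Icc_mem_nhds hs.1 hs.2)).congr hev)
  have hm : Measurable fun r => bracket (X r) (deriv Y r) := by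
    have h1 := hX.continuous.measurable
    have h2 := measurable_deriv Y
    unfold bracket
    fun_prop
  exact hm.stronglyMeasurable.stronglyMeasurableAtFilter

/-- Integration by parts for closed curves. -/
theorem integral_bracket_comm (hX : P.IsAdmissible X) (hY : P.IsAdmissible Y) {a b : ℝ}
    (ha : 0 ≤ a) (hab : a ≤ b) :
    (∫ s in a..b, bracket (X s) (deriv Y s)) - ∫ s in a..b, bracket (Y s) (deriv X s) =
      bracket (X b) (Y b) - bracket (X a) (Y a) := by
  have hb := ha.trans hab
  rw [integral_eq_primitive_sub hX hY ha hb, integral_eq_primitive_sub hY hX ha hb]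
  have := P.eq_of_hasDerivAt_zero
    (f := fun s => primitive X Y s - primitive Y X s - bracket (X s) (Y s)) ha hab
    (((continuousOn_primitive hX hY ha).sub (continuousOn_primitive hY hX ha)).sub
      (hX.continuous.bracket hY.continuous).continuousOn)
    (fun i s hs _ => by
      refine (((hasDerivAt_primitive hX hY hs).sub (hasDerivAt_primitive hY hX hs)).sub
        ((hX.hasDerivAt hs).bracket (hY.hasDerivAt hs))).congr_deriv ?_
      rw [bracket_swap (Y s)]; ring)
  linarith

theorem two_T_eq (P : SmoothByPartsPlane) : 2 * P.T = P.t (2 * P.n) := by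
  rw [P.t_mul]; norm_num

theorem integral_bracket_pos (hX : P.IsAdmissible X) (hY : P.IsAdmissible Y)
    (h : ∀ i, ∀ s ∈ P.arc i, 0 < bracket (X s) (P.velocity Y i s)) :
    0 < ∫ s in (0 : ℝ)..2 * P.T, bracket (X s) (deriv Y s) := by
  have key : ∀ k : ℕ, 0 < ∫ s in (0 : ℝ)..P.t (k + 1), bracket (X s) (deriv Y s) := by
    have h1 : ∀ i, 0 < ∫ s in P.t i..P.t (i + 1), bracket (X s) (deriv Y s) := fun i =>
      intervalIntegral.intervalIntegral_pos_of_pos_on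
        (intervalIntegrable_bracket_deriv hX hY (P.t_nonneg _) (P.t_nonneg _))
        (fun s hs => by rw [hY.deriv_eq hs]; exact h i s (Ioo_subset_Icc_self hs)) (P.t_lt i)
    intro k
    induction k with
    | zero => have := h1 0; rwa [P.t_zero] at this
    | succ k ih =>
      rw [← intervalIntegral.integral_add_adjacent_intervals
        (intervalIntegrable_bracket_deriv hX hY le_rfl (P.t_nonneg (k + 1)))
        (intervalIntegrable_bracket_deriv hX hY (P.t_nonneg _) (P.t_nonneg _))]
      exact add_pos ih (h1 (k + 1))
  rw [two_T_eq]
  have := P.n_pos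
  obtain ⟨k, hk⟩ := Nat.exists_eq_succ_of_ne_zero (show 2 * P.n ≠ 0 by omega)
  rw [hk]
  exact key k

/-- The factor `ε` lets the periodic case (`ε = 1`) and the antiperiodic case (`ε = -1`) share one
argument. -/
theorem deriv_add_half_period {ε : ℝ} (h : ∀ s, X (s + P.T) = ε • X s) (s : ℝ) :
    deriv X (s + P.T) = ε • deriv X s := by
  rw [← deriv_comp_add_const, show (fun s => X (s + P.T)) = ε • X from funext h]
  exact deriv_const_smul_field ε X

/-- The integral over a period is twice the integral over a half period. -/
theorem integral_eq_two_mul (hX : P.IsAdmissible X) (hY : P.IsAdmissible Y) {ε : ℝ}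
    (hε : ε * ε = 1) (h : ∀ s, X (s + P.T) = ε • X s) (h' : ∀ s, Y (s + P.T) = ε • Y s) (a : ℝ) :
    ∫ s in (0 : ℝ)..2 * P.T, bracket (X s) (deriv Y s) =
      2 * ∫ s in a..a + P.T, bracket (X s) (deriv Y s) := by
  have hper : Function.Periodic (fun s => bracket (X s) (deriv Y s)) P.T := by
    intro s
    simp only [h, deriv_add_half_period h', bracket_smul_left, bracket_smul_right]
    rw [← mul_assoc, hε, one_mul]
  have hT := P.T_pos
  rw [← intervalIntegral.integral_add_adjacent_intervals
    (intervalIntegrable_bracket_deriv hX hY le_rfl hT.le)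
    (intervalIntegrable_bracket_deriv hX hY hT.le P.two_T_pos.le)]
  have h1 := hper.intervalIntegral_add_eq 0 a
  have h2 := hper.intervalIntegral_add_eq P.T a
  rw [zero_add] at h1
  rw [← two_mul] at h2
  rw [h1, h2]; ring

theorem signedArea_eq (hX : P.IsAdmissible X) {ε : ℝ} (hε : ε * ε = 1)
    (h : ∀ s, X (s + P.T) = ε • X s) (a : ℝ) :
    P.signedArea X = ∫ s in a..a + P.T, bracket (X s) (deriv X s) := by
  unfold signedArea mixedArea
  rw [integral_eq_two_mul hX hX hε h h a]; ring

end SmoothByPartsPlane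

namespace SmoothByPartsPlane

variable {P : SmoothByPartsPlane} {X Y : ℝ → ℝ × ℝ} {e : ℝ × ℝ} {i : ℕ} {p q : ℝ}

/-! ### The area excess of an admissible curve along one arc -/

theorem straight_bracket_eq_zero (h : IsStraightArc P.u (P.t i) (P.t (i + 1))) {r s : ℝ}
    (hr : r ∈ P.arc i) (hs : s ∈ P.arc i) (h0 : bracket e (P.D i r) = 0) :
    bracket e (P.D i s) = 0 := by
  obtain ⟨c, hc⟩ := P.straight_exists_smul' h hr hs
  rw [hc, bracket_smul_right, h0, mul_zero]

theorem IsAdmissible.bracket_velocity_eq_zero (hX : P.IsAdmissible X) {s : ℝ}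
    (hs : s ∈ P.arc i) {x : ℝ × ℝ} (h : bracket x (P.D i s) = 0) :
    bracket x (P.velocity X i s) = 0 := by
  obtain ⟨r, hr, -⟩ := hX.exists_radius i
  rw [hr s hs, bracket_smul_right]
  exact mul_eq_zero_of_right _ h

theorem bracket_eq_zero_of_bracket_eq_zero {x y : ℝ × ℝ} (he : e ≠ 0) (hx : bracket e x = 0)
    (hy : bracket e y = 0) : bracket x y = 0 := by
  obtain ⟨c, rfl⟩ := exists_smul_of_bracket_eq_zero hx he
  rw [bracket_smul_left, hy, mul_zero]

variable (P) in
/-- The boundary term in the area formula: `[e, X] [X, u'] / [e, u']`. -/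
noncomputable def boundaryTerm (X : ℝ → ℝ × ℝ) (e : ℝ × ℝ) (i : ℕ) (s : ℝ) : ℝ :=
  bracket e (X s) * bracket (X s) (P.D i s) / bracket e (P.D i s)

variable (P) in
/-- The boundary term corrected by the area swept out. -/
noncomputable def areaExcess (X : ℝ → ℝ × ℝ) (e : ℝ × ℝ) (i : ℕ) (s : ℝ) : ℝ :=
  P.boundaryTerm X e i s - primitive X X s

/-- Since `X' = r u'`, the term `[X', u']` drops out and `[e, X'] / [e, u'] = r` produces `[X, X']`.
The Plücker relation collects the two terms in `u''` into `[e, X]² [u', u'']`. -/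
theorem hasDerivAt_boundaryTerm (hX : P.IsAdmissible X) {s : ℝ}
    (hs : s ∈ Ioo (P.t i) (P.t (i + 1))) (h : bracket e (P.D i s) ≠ 0) :
    HasDerivAt (P.boundaryTerm X e i) (bracket (X s) (P.velocity X i s) +
      bracket e (X s) ^ 2 * bracket (P.D i s) (P.D2 i s) / bracket e (P.D i s) ^ 2) s := by
  have hsi := Ioo_subset_Icc_self hs
  obtain ⟨r, hr, -⟩ := hX.exists_radius i
  have hD : HasDerivAt (P.D i) (P.D2 i s) s :=
    (P.hasDerivWithinAt_D hsi).hasDerivAt (Icc_mem_nhds hs.1 hs.2)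
  have hXd := hX.hasDerivAt hs
  have he := hasDerivAt_const s e
  have := ((he.bracket hXd).mul (hXd.bracket hD)).div (he.bracket hD) h
  refine this.congr_deriv ?_
  rw [hr s hsi]
  simp only [Pi.mul_apply, bracket_zero_left, zero_add, bracket_smul_right, bracket_smul_left, bracket_self, mul_zero]
  have h2 : bracket e (P.velocity P.u i s) ≠ 0 := h
  have hpl := bracket_plucker (X s) (P.D2 i s) e (P.D i s)
  simp only [D] at hpl ⊢
  have hs1 := bracket_swap (P.D2 i s) (P.velocity P.u i s)
  have hs2 := bracket_swap (X s) e
  rw [hs1, hs2] at hpl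
  field_simp
  linear_combination (bracket e (X s)) * hpl

/-- An interior zero is a minimum of `[e, u']`, so `[e, u''] = 0` as well; independence of `u'` and
`u''` then gives `e = 0`. -/
theorem strictlyConvex_bracket_pos (he : e ≠ 0)
    (hi : IsStrictlyConvexArc P.u (P.t i) (P.t (i + 1))) (hsub : Icc p q ⊆ P.arc i)
    (hq : ∀ s ∈ Icc p q, 0 ≤ bracket e (P.D i s)) {s : ℝ} (hs : s ∈ Ioo p q) :
    0 < bracket e (P.D i s) := by
  refine lt_of_le_of_ne (hq s (Ioo_subset_Icc_self hs)) fun h0 => ?_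
  have hsi := hsub (Ioo_subset_Icc_self hs)
  have hD : HasDerivAt (P.D i) (P.D2 i s) s := ((P.hasDerivWithinAt_D hsi).mono hsub).hasDerivAt
    (Icc_mem_nhds hs.1 hs.2)
  have hd := (hasDerivAt_const s e).bracket hD
  have hmin : IsLocalMin (fun r => bracket e (P.D i r)) s := by
    filter_upwards [Icc_mem_nhds hs.1 hs.2] with r hr
    rw [← h0]; exact hq r hr
  have h1 := hmin.hasDerivAt_eq_zero hd
  rw [bracket_zero_left, zero_add] at h1
  exact he (eq_zero_of_bracket_eq_zero h0.symm h1 (hi s hsi))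

/-- At a zero of `[e, u']` on a strictly convex arc the denominator has a simple zero, while `[e,
X]` and its derivative `r [e, u']` both vanish; hence the quotient tends to `0`, its value by the
convention `x / 0 = 0`. -/
theorem continuousOn_boundaryTerm (hX : P.IsAdmissible X) (he : e ≠ 0) (hsub : Icc p q ⊆ P.arc i)
    (hb : ∀ s ∈ Icc p q, bracket e (P.D i s) = 0 → bracket e (X s) = 0) :
    ContinuousOn (P.boundaryTerm X e i) (Icc p q) := by
  intro s hs
  have hsi := hsub hs
  refine ContinuousWithinAt.mono (t := P.arc i) ?_ hsub
  have hcX := hX.continuous.continuousOn (s := P.arc i)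
  have h1 := (continuousOn_const (c := e)).bracket hcX s hsi
  have h2 := hcX.bracket (P.continuousOn_D i) s hsi
  have h3 := (continuousOn_const (c := e)).bracket (P.continuousOn_D i) s hsi
  by_cases h0 : bracket e (P.D i s) = 0
  swap
  · exact (h1.mul h2).div h3 h0
  rcases P.arc_type i with hi | hi
  swap
  -- On a straight arc `[e, u']` then vanishes identically, and so does the boundary term by the
  -- same convention.
  · have : ∀ r ∈ P.arc i, P.boundaryTerm X e i r = 0 := fun r hr => by
      rw [boundaryTerm, straight_bracket_eq_zero hi hsi hr h0, div_zero]
    exact continuousWithinAt_const.congr this (this s hsi)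
  have hy0 := hb s hs h0
  have hc := hasDerivWithinAt_const s (P.arc i) e
  have hyd := hc.bracket (hX.hasDerivWithinAt hsi)
  have hqd := hc.bracket (P.hasDerivWithinAt_D hsi)
  rw [bracket_zero_left, zero_add] at hyd hqd
  rw [hX.bracket_velocity_eq_zero hsi h0] at hyd
  have hne : bracket e (P.D2 i s) ≠ 0 := fun h =>
    he (eq_zero_of_bracket_eq_zero h0 h (hi s hsi))
  have hlim := ((hasDerivWithinAt_iff_tendsto_slope.mp hyd).div
    (hasDerivWithinAt_iff_tendsto_slope.mp hqd) hne).mul (h2.mono sdiff_subset).tendsto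
  rw [zero_div, zero_mul] at hlim
  rw [← continuousWithinAt_sdiff_self]
  have hval : P.boundaryTerm X e i s = 0 := by rw [boundaryTerm, h0, div_zero]
  unfold ContinuousWithinAt
  rw [hval]
  refine hlim.congr' ?_
  filter_upwards [self_mem_nhdsWithin] with r hr
  have hrs : r - s ≠ 0 := sub_ne_zero.mpr hr.2
  simp only [Pi.div_apply, slope_def_field, hy0, h0, sub_zero, boundaryTerm]
  rw [div_div_div_cancel_right₀ hrs]
  ring

theorem continuousOn_areaExcess (hX : P.IsAdmissible X) (he : e ≠ 0) (hsub : Icc p q ⊆ P.arc i)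
    (hb : ∀ s ∈ Icc p q, bracket e (P.D i s) = 0 → bracket e (X s) = 0) :
    ContinuousOn (P.areaExcess X e i) (Icc p q) :=
  (continuousOn_boundaryTerm hX he hsub hb).sub
    ((continuousOn_primitive hX hX (P.t_nonneg i)).mono hsub)

theorem hasDerivAt_areaExcess (hX : P.IsAdmissible X) (he : e ≠ 0) (hsub : Icc p q ⊆ P.arc i)
    (hq : ∀ s ∈ Icc p q, 0 ≤ bracket e (P.D i s))
    (hb : ∀ s ∈ Icc p q, bracket e (P.D i s) = 0 → bracket e (X s) = 0) {s : ℝ}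
    (hs : s ∈ Ioo p q) (hs' : s ∈ Ioo (P.t i) (P.t (i + 1))) :
    HasDerivAt (P.areaExcess X e i)
      (bracket e (X s) ^ 2 * bracket (P.D i s) (P.D2 i s) / bracket e (P.D i s) ^ 2) s := by
  have hI := hasDerivAt_primitive hX hX hs'
  by_cases h0 : bracket e (P.D i s) = 0
  swap
  · exact ((hasDerivAt_boundaryTerm hX hs' h0).sub hI).congr_deriv (by ring)
  rcases P.arc_type i with hi | hi
  · exact absurd h0 (strictlyConvex_bracket_pos he hi hsub hq hs).ne'
  have hsi := Ioo_subset_Icc_self hs'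
  have hev : P.boundaryTerm X e i =ᶠ[nhds s] fun _ => 0 := by
    filter_upwards [Icc_mem_nhds hs'.1 hs'.2] with r hr
    rw [boundaryTerm, straight_bracket_eq_zero hi hsi hr h0, div_zero]
  have h1 := ((hasDerivAt_const s (0 : ℝ)).congr_of_eventuallyEq hev).sub hI
  refine h1.congr_deriv ?_
  -- Here `X`, `e` and `u'` are parallel, so no area is swept out, and the claimed derivative is a
  -- quotient by `0`, hence `0`.
  rw [hX.bracket_velocity_eq_zero hsi (bracket_eq_zero_of_bracket_eq_zero he
    (hb s (Ioo_subset_Icc_self hs) h0) h0), h0]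
  simp

theorem Ioo_subset_of_Icc_subset (hsub : Icc p q ⊆ P.arc i) :
    Ioo p q ⊆ Ioo (P.t i) (P.t (i + 1)) := by
  have := interior_mono hsub
  rwa [interior_Icc, interior_Icc] at this

theorem monotoneOn_areaExcess (hX : P.IsAdmissible X) (he : e ≠ 0) (hsub : Icc p q ⊆ P.arc i)
    (hq : ∀ s ∈ Icc p q, 0 ≤ bracket e (P.D i s))
    (hb : ∀ s ∈ Icc p q, bracket e (P.D i s) = 0 → bracket e (X s) = 0) :
    MonotoneOn (P.areaExcess X e i) (Icc p q) := by
  refine monotoneOn_of_hasDerivWithinAt_nonneg (convex_Icc p q)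
    (continuousOn_areaExcess hX he hsub hb)
    (f' := fun s => bracket e (X s) ^ 2 * bracket (P.D i s) (P.D2 i s) / bracket e (P.D i s) ^ 2)
    (fun s hs => ?_) (fun s hs => ?_)
  · rw [interior_Icc] at hs
    exact (hasDerivAt_areaExcess hX he hsub hq hb hs
      (Ioo_subset_of_Icc_subset hsub hs)).hasDerivWithinAt
  · rw [interior_Icc] at hs
    exact div_nonneg (mul_nonneg (sq_nonneg _)
      (P.bracket_D_D2_nonneg (Ioo_subset_of_Icc_subset hsub hs))) (sq_nonneg _)

/-- A monotone function with equal end values is constant, so its derivative vanishes; with `[u',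
u''] ≠ 0` only `[e, X] = 0` remains. -/
theorem bracket_eq_zero_of_areaExcess_eq (hX : P.IsAdmissible X) (he : e ≠ 0)
    (hi : IsStrictlyConvexArc P.u (P.t i) (P.t (i + 1))) (hpq : p < q)
    (hsub : Icc p q ⊆ P.arc i)
    (hq : ∀ s ∈ Icc p q, 0 ≤ bracket e (P.D i s))
    (hb : ∀ s ∈ Icc p q, bracket e (P.D i s) = 0 → bracket e (X s) = 0)
    (heq : P.areaExcess X e i p = P.areaExcess X e i q) {s : ℝ} (hs : s ∈ Icc p q) :
    bracket e (X s) = 0 := by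
  have hmono := monotoneOn_areaExcess hX he hsub hq hb
  have hcl : closure (Ioo p q) = Icc p q := closure_Ioo hpq.ne
  have hcX : Continuous fun s => bracket e (X s) := continuous_const.bracket hX.continuous
  have key : EqOn (fun s => bracket e (X s)) (fun _ => 0) (Ioo p q) := by
    intro s hs
    have hs' := Ioo_subset_of_Icc_subset hsub hs
    have hd := hasDerivAt_areaExcess hX he hsub hq hb hs hs'
    have hev : P.areaExcess X e i =ᶠ[nhds s] fun _ => P.areaExcess X e i p := by
      filter_upwards [Icc_mem_nhds hs.1 hs.2] with r hr
      refine le_antisymm ?_ (hmono (left_mem_Icc.mpr hpq.le) hr hr.1)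
      rw [heq]; exact hmono hr (right_mem_Icc.mpr hpq.le) hr.2
    have h0 := hd.unique ((hasDerivAt_const s _).congr_of_eventuallyEq hev)
    have hpos := strictlyConvex_bracket_pos he hi hsub hq hs
    have hne : bracket (P.D i s) (P.D2 i s) ≠ 0 := hi s (Ioo_subset_Icc_self hs')
    rcases div_eq_zero_iff.mp h0 with h | h
    · exact pow_eq_zero_iff two_ne_zero |>.mp ((mul_eq_zero.mp h).resolve_right hne)
    · exact absurd h (pow_pos hpos 2).ne'
  exact (key.closure hcX continuous_const) (hcl ▸ hs)

/-- The jump of the boundary term at a division point. -/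
theorem boundaryTerm_jump {s : ℝ} (h1 : bracket e (P.D i s) ≠ 0)
    (h2 : bracket e (P.D (i + 1) s) ≠ 0) :
    P.boundaryTerm X e (i + 1) s - P.boundaryTerm X e i s =
      bracket e (X s) ^ 2 * bracket (P.D i s) (P.D (i + 1) s) /
        (bracket e (P.D i s) * bracket e (P.D (i + 1) s)) := by
  unfold boundaryTerm
  rw [div_sub_div _ _ h2 h1, div_eq_div_iff (mul_ne_zero h2 h1) (mul_ne_zero h1 h2)]
  simp only [bracket]
  ring

end SmoothByPartsPlane

namespace SmoothByPartsPlane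

variable {P : SmoothByPartsPlane} {X Y : ℝ → ℝ × ℝ} {e : ℝ × ℝ} {j l : ℕ} {a b : ℝ}

/-! ### The area inequality along a half turn -/

variable (P) in
/-- On `[a, b]`, which reaches from the `j`-th to the `l`-th arc, the tangent direction of the
unit circle stays on the left of `e`, and the chord of `X` over `[a, b]` lies on `ℝ e`. -/
structure IsChordDirection (X : ℝ → ℝ × ℝ) (e : ℝ × ℝ) (j l : ℕ) (a b : ℝ) : Prop where
  ne_zero : e ≠ 0
  index_le : j ≤ l
  index_le_add : l ≤ j + P.n
  left_mem : a ∈ P.arc j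
  right_mem : b ∈ P.arc l
  le : a ≤ b
  le_add : b ≤ a + P.T
  left_eq : bracket e (X a) = 0
  right_eq : bracket e (X b) = 0
  nonneg : ∀ i, j ≤ i → i ≤ l → ∀ s ∈ P.arc i, s ∈ Icc a b → 0 ≤ bracket e (P.D i s)

namespace IsChordDirection

theorem nonneg_left (h : P.IsChordDirection X e j l a b) : 0 ≤ a :=
  (P.t_nonneg j).trans h.left_mem.1

/-- The function `[e, u']` has no zero between two points where it is positive. -/
theorem ne_zero_between (h : P.IsChordDirection X e j l a b) {i k m : ℕ} {r s x : ℝ}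
    (hj : j ≤ i) (hik : i ≤ k) (hkm : k ≤ m) (hm : m ≤ l) (hr : r ∈ P.arc i)
    (hs : s ∈ P.arc k) (hx : x ∈ P.arc m) (har : a ≤ r) (hrs : r ≤ s) (hsx : s ≤ x) (hxb : x ≤ b)
    (h1 : 0 < bracket e (P.D i r)) (h2 : 0 < bracket e (P.D m x)) :
    bracket e (P.D k s) ≠ 0 := by
  intro h0
  have hl := h.index_le_add
  have hba := h.le_add
  -- With `u'(s) = c e`, turning from `r` to `s` forces `c ≤ 0` and turning from `s` to `x` forces
  -- `c ≥ 0`.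
  obtain ⟨c, hc⟩ := exists_smul_of_bracket_eq_zero h0 h.ne_zero
  have h3 := P.bracket_D_nonneg hr hs hik (by omega) hrs (by linarith)
  have h4 := P.bracket_D_nonneg hs hx hkm (by omega) hsx (by linarith)
  rw [hc, bracket_smul_right, bracket_swap] at h3
  rw [hc, bracket_smul_left] at h4
  have hc0 : c = 0 := by
    apply le_antisymm
    · by_contra hcon
      nlinarith [mul_pos (not_le.mp hcon) h1]
    · by_contra hcon
      nlinarith [mul_pos_of_neg_of_neg (not_le.mp hcon) (neg_lt_zero.mpr h2)]
  exact P.D_ne_zero hs (by rw [hc, hc0, zero_smul])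

theorem index_bounds (h : P.IsChordDirection X e j l a b) {i : ℕ} {s : ℝ}
    (hs : s ∈ Ioo (P.t i) (P.t (i + 1))) (hsab : s ∈ Icc a b) : j ≤ i ∧ i ≤ l := by
  have h1 : P.t j < P.t (i + 1) := (h.left_mem.1.trans hsab.1).trans_lt hs.2
  have h2 : P.t i < P.t (l + 1) := hs.1.trans_le (hsab.2.trans h.right_mem.2)
  have h3 := P.t_strictMono.lt_iff_lt.mp h1
  have h4 := P.t_strictMono.lt_iff_lt.mp h2
  omega

/-- Where the tangent of the unit circle is parallel to `e`, the curve crosses the line `ℝ e`. -/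
theorem bracket_eq_zero (h : P.IsChordDirection X e j l a b) (hX : P.IsAdmissible X) {k : ℕ}
    {s : ℝ} (hl : k ≤ l) (hs : s ∈ P.arc k) (hsab : s ∈ Icc a b)
    (h0 : bracket e (P.D k s) = 0) : bracket e (X s) = 0 := by
  have hcX : Continuous fun s => bracket e (X s) := continuous_const.bracket hX.continuous
  have hd : ∀ i, ∀ r ∈ Ioo (P.t i) (P.t (i + 1)), bracket e (P.D i r) = 0 →
      HasDerivAt (fun s => bracket e (X s)) 0 r := by
    intro i r hr hr0
    refine ((hasDerivAt_const r e).bracket (hX.hasDerivAt hr)).congr_deriv ?_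
    rw [bracket_zero_left, zero_add,
      hX.bracket_velocity_eq_zero (Ioo_subset_Icc_self hr) hr0]
  -- Either `[e, u']` vanishes all the way from `a` to `s`, or it is positive somewhere before and
  -- then, by `ne_zero_between`, vanishes inside the arcs from `s` to `b`. In both cases `[e, X]` is
  -- constant up to an end, where it is `0`.
  by_cases hleft : ∀ i, j ≤ i → i ≤ k → ∀ r ∈ P.arc i, a ≤ r → r ≤ s → bracket e (P.D i r) = 0
  · have := P.eq_of_hasDerivAt_zero h.nonneg_left hsab.1 hcX.continuousOn (fun i r hr hr' => by
      have hb := h.index_bounds hr ⟨hr'.1.le, hr'.2.le.trans hsab.2⟩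
      have : P.t i < P.t (k + 1) := hr.1.trans_le (hr'.2.le.trans hs.2)
      have := P.t_strictMono.lt_iff_lt.mp this
      exact hd i r hr (hleft i hb.1 (by omega) r (Ioo_subset_Icc_self hr) hr'.1.le hr'.2.le))
    rw [this, h.left_eq]
  · push Not at hleft
    obtain ⟨i, hji, hik, r, hr, har, hrs, hne⟩ := hleft
    have hpos := lt_of_le_of_ne (h.nonneg i hji (hik.trans hl) r hr ⟨har, hrs.trans hsab.2⟩)
      hne.symm
    have := P.eq_of_hasDerivAt_zero (h.nonneg_left.trans hsab.1) hsab.2 hcX.continuousOn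
      (fun m x hx hx' => by
        have hb := h.index_bounds hx ⟨hsab.1.trans hx'.1.le, hx'.2.le⟩
        have : P.t k < P.t (m + 1) := hs.1.trans_lt (hx'.1.trans hx.2)
        have := P.t_strictMono.lt_iff_lt.mp this
        have hxm := Ioo_subset_Icc_self hx
        refine hd m x hx ?_
        by_contra hne'
        have hpos' := lt_of_le_of_ne (h.nonneg m hb.1 hb.2 x hxm
          ⟨hsab.1.trans hx'.1.le, hx'.2.le⟩) (Ne.symm hne')
        exact h.ne_zero_between hji hik (by omega) hb.2 hr hs hxm har hrs hx'.1.le hx'.2.le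
          hpos hpos' h0)
    rw [← this, h.right_eq]

theorem mem_Icc_division (h : P.IsChordDirection X e j l a b) {i k : ℕ} (hj : j ≤ i)
    (hik : i < k) (hk : k ≤ l) : P.t k ∈ Icc a b := by
  refine ⟨h.left_mem.2.trans (P.t_strictMono.monotone (by omega)),
    (P.t_strictMono.monotone hk).trans h.right_mem.1⟩

theorem monotone_arc (h : P.IsChordDirection X e j l a b) (hX : P.IsAdmissible X) {i : ℕ}
    {r s : ℝ} (hj : j ≤ i) (hl : i ≤ l) (hr : r ∈ P.arc i) (hs : s ∈ P.arc i) (har : a ≤ r)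
    (hrs : r ≤ s) (hsb : s ≤ b) : P.areaExcess X e i r ≤ P.areaExcess X e i s := by
  have hsub : Icc r s ⊆ P.arc i := Icc_subset_Icc hr.1 hs.2
  have hsub' : Icc r s ⊆ Icc a b := Icc_subset_Icc har hsb
  exact monotoneOn_areaExcess hX h.ne_zero hsub
    (fun x hx => h.nonneg i hj hl x (hsub hx) (hsub' hx))
    (fun x hx => h.bracket_eq_zero hX hl (hsub hx) (hsub' hx))
    (left_mem_Icc.mpr hrs) (right_mem_Icc.mpr hrs) hrs

/-- If `[e, X] = 0` at the vertex, both boundary terms vanish. Otherwise both one-sided values of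
`[e, u']` are positive and the jump formula applies. -/
theorem jump (h : P.IsChordDirection X e j l a b) (hX : P.IsAdmissible X) {i : ℕ}
    (hj : j ≤ i) (hl : i + 1 ≤ l) :
    P.areaExcess X e i (P.t (i + 1)) ≤ P.areaExcess X e (i + 1) (P.t (i + 1)) ∧
    (P.areaExcess X e i (P.t (i + 1)) = P.areaExcess X e (i + 1) (P.t (i + 1)) →
      bracket (P.D i (P.t (i + 1))) (P.D (i + 1) (P.t (i + 1))) ≠ 0 →
        bracket e (X (P.t (i + 1))) = 0) := by
  have hab := h.mem_Icc_division hj (Nat.lt_succ_self i) hl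
  have hm1 := P.right_mem_arc i
  have hm2 := P.left_mem_arc (i + 1)
  have hn := P.n_pos
  by_cases hy : bracket e (X (P.t (i + 1))) = 0
  · refine ⟨?_, fun _ _ => hy⟩
    simp [areaExcess, boundaryTerm, hy]
  have h1 : 0 < bracket e (P.D i (P.t (i + 1))) :=
    lt_of_le_of_ne (h.nonneg i hj (by omega) _ hm1 hab)
      fun h0 => hy (h.bracket_eq_zero hX (by omega) hm1 hab h0.symm)
  have h2 : 0 < bracket e (P.D (i + 1) (P.t (i + 1))) :=
    lt_of_le_of_ne (h.nonneg (i + 1) (by omega) hl _ hm2 hab)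
      fun h0 => hy (h.bracket_eq_zero hX hl hm2 hab h0.symm)
  have h3 := P.bracket_D_nonneg hm1 hm2 (by omega) (by omega) le_rfl (by linarith [P.T_pos])
  have hjump := boundaryTerm_jump (X := X) h1.ne' h2.ne'
  have hpos : 0 ≤ bracket e (X (P.t (i + 1))) ^ 2 *
      bracket (P.D i (P.t (i + 1))) (P.D (i + 1) (P.t (i + 1))) /
        (bracket e (P.D i (P.t (i + 1))) * bracket e (P.D (i + 1) (P.t (i + 1)))) :=
    div_nonneg (mul_nonneg (sq_nonneg _) h3) (mul_pos h1 h2).le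
  refine ⟨?_, fun heq hne => ?_⟩
  · unfold areaExcess; linarith
  · exfalso
    unfold areaExcess at heq
    have h0 : P.boundaryTerm X e (i + 1) (P.t (i + 1)) - P.boundaryTerm X e i (P.t (i + 1)) = 0 := by
      linarith
    rw [hjump] at h0
    rcases div_eq_zero_iff.mp h0 with h0 | h0
    · exact (mul_ne_zero (pow_ne_zero 2 hy) hne) h0
    · exact (mul_pos h1 h2).ne' h0

theorem monotone (h : P.IsChordDirection X e j l a b) (hX : P.IsAdmissible X) {i k : ℕ}
    {r s : ℝ} (hj : j ≤ i) (hik : i ≤ k) (hl : k ≤ l) (hr : r ∈ P.arc i) (hs : s ∈ P.arc k)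
    (har : a ≤ r) (hrs : r ≤ s) (hsb : s ≤ b) :
    P.areaExcess X e i r ≤ P.areaExcess X e k s := by
  induction k, hik using Nat.le_induction generalizing s with
  | base => exact h.monotone_arc hX hj hl hr hs har hrs hsb
  | succ k hik ih =>
    have hrt : r ≤ P.t (k + 1) := hr.2.trans (P.t_strictMono.monotone (by omega))
    calc _ ≤ P.areaExcess X e k (P.t (k + 1)) :=
          ih (by omega) (P.right_mem_arc k) hrt (hs.1.trans hsb)
      _ ≤ P.areaExcess X e (k + 1) (P.t (k + 1)) := (h.jump hX (by omega) hl).1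
      _ ≤ _ := h.monotone_arc hX (by omega) hl (P.left_mem_arc (k + 1)) hs (har.trans hrt)
          hs.1 hsb

theorem integral_eq (h : P.IsChordDirection X e j l a b) (hX : P.IsAdmissible X) :
    ∫ s in a..b, bracket (X s) (deriv X s) = P.areaExcess X e j a - P.areaExcess X e l b := by
  rw [integral_eq_primitive_sub hX hX h.nonneg_left (h.nonneg_left.trans h.le)]
  simp [areaExcess, boundaryTerm, h.left_eq, h.right_eq]
  ring

/-- The area inequality along a half turn. -/
theorem integral_nonpos (h : P.IsChordDirection X e j l a b) (hX : P.IsAdmissible X) :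
    ∫ s in a..b, bracket (X s) (deriv X s) ≤ 0 := by
  rw [h.integral_eq hX]
  linarith [h.monotone hX le_rfl h.index_le le_rfl h.left_mem h.right_mem le_rfl h.le le_rfl]

/-- The equality case: the curve runs on the line `ℝ e`. -/
theorem bracket_eq_zero_of_integral_eq_zero (h : P.IsChordDirection X e j l a b)
    (hX : P.IsAdmissible X) (h0 : ∫ s in a..b, bracket (X s) (deriv X s) = 0) {s : ℝ}
    (hs : s ∈ Icc a b) : bracket e (X s) = 0 := by
  rw [h.integral_eq hX, sub_eq_zero] at h0
  have hconst : ∀ i, j ≤ i → i ≤ l → ∀ s ∈ P.arc i, s ∈ Icc a b →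
      P.areaExcess X e i s = P.areaExcess X e j a := fun i hj hl s hs hsab =>
    le_antisymm (h0 ▸ h.monotone hX hj hl le_rfl hs h.right_mem hsab.1 hsab.2 le_rfl)
      (h.monotone hX le_rfl hj hl h.left_mem hs le_rfl hsab.1 hsab.2)
  have hconvex : ∀ i, j ≤ i → i ≤ l → IsStrictlyConvexArc P.u (P.t i) (P.t (i + 1)) →
      ∀ s ∈ P.arc i, s ∈ Icc a b → bracket e (X s) = 0 := by
    intro i hj hl hi s hs hsab
    rcases hsab.1.eq_or_lt with rfl | has
    · exact h.left_eq
    rcases hsab.2.eq_or_lt with rfl | hsb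
    · exact h.right_eq
    -- The part of the arc inside `[a, b]`; it is nondegenerate because `a < s < b`.
    have hsub : Icc (max a (P.t i)) (min b (P.t (i + 1))) ⊆ P.arc i :=
      Icc_subset_Icc (le_max_right _ _) (min_le_right _ _)
    have hsub' : Icc (max a (P.t i)) (min b (P.t (i + 1))) ⊆ Icc a b :=
      Icc_subset_Icc (le_max_left _ _) (min_le_left _ _)
    have hs1 : max a (P.t i) ≤ s := max_le has.le hs.1
    have hs2 : s ≤ min b (P.t (i + 1)) := le_min hsb.le hs.2
    have hpq : max a (P.t i) < min b (P.t (i + 1)) := by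
      rcases hs.1.eq_or_lt with h1 | h1
      · exact hs1.trans_lt (lt_min hsb (h1 ▸ P.t_lt i))
      · exact (max_lt has h1).trans_le hs2
    have hp := left_mem_Icc.mpr hpq.le
    have hq := right_mem_Icc.mpr hpq.le
    exact bracket_eq_zero_of_areaExcess_eq hX h.ne_zero hi hpq hsub
      (fun x hx => h.nonneg i hj hl x (hsub hx) (hsub' hx))
      (fun x hx => h.bracket_eq_zero hX hl (hsub hx) (hsub' hx))
      ((hconst i hj hl _ (hsub hp) (hsub' hp)).trans
        (hconst i hj hl _ (hsub hq) (hsub' hq)).symm) ⟨hs1, hs2⟩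
  -- A division point touches a strictly convex arc, or separates two straight arcs that are not
  -- collinear, where the jump must vanish.
  have hdiv : ∀ i, j ≤ i → i + 1 ≤ l → bracket e (X (P.t (i + 1))) = 0 := by
    intro i hj hl
    have hab := h.mem_Icc_division hj (Nat.lt_succ_self i) hl
    rcases P.arc_type i with hi | hi
    · exact hconvex i hj (by omega) hi _ (P.right_mem_arc i) hab
    rcases P.arc_type (i + 1) with hi' | hi'
    · exact hconvex (i + 1) (by omega) hl hi' _ (P.left_mem_arc (i + 1)) hab
    · exact (h.jump hX hj hl).2 ((hconst i hj (by omega) _ (P.right_mem_arc i) hab).trans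
        (hconst (i + 1) (by omega) hl _ (P.left_mem_arc (i + 1)) hab).symm)
        (P.straight_vertex hi hi')
  obtain ⟨i, hj, hl, hsi⟩ := P.exists_mem_arc h.index_le h.left_mem h.right_mem hs
  rcases P.arc_type i with hi | hi
  · exact hconvex i hj hl hi s hsi hs
  have hp0 : ∃ p, p ∈ P.arc i ∧ a ≤ p ∧ p ≤ s ∧ bracket e (X p) = 0 := by
    rcases le_or_gt (P.t i) a with h1 | h1
    · exact ⟨a, ⟨h1, hs.1.trans hsi.2⟩, le_rfl, hs.1, h.left_eq⟩
    · have hji : j < i := P.t_strictMono.lt_iff_lt.mp (h.left_mem.1.trans_lt h1)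
      obtain ⟨k, rfl⟩ := Nat.exists_eq_succ_of_ne_zero (show i ≠ 0 by omega)
      exact ⟨_, P.left_mem_arc _, h1.le, hsi.1, hdiv k (by omega) (by omega)⟩
  have hq0 : ∃ q, q ∈ P.arc i ∧ q ≤ b ∧ s ≤ q ∧ bracket e (X q) = 0 := by
    rcases le_or_gt b (P.t (i + 1)) with h1 | h1
    · exact ⟨b, ⟨hsi.1.trans hs.2, h1⟩, le_rfl, hs.2, h.right_eq⟩
    · have hil : i + 1 < l + 1 := P.t_strictMono.lt_iff_lt.mp (h1.trans_le h.right_mem.2)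
      exact ⟨_, P.right_mem_arc _, h1.le, hsi.2, hdiv i hj (by omega)⟩
  obtain ⟨p, hp, hap, hps, hyp⟩ := hp0
  obtain ⟨q, hq, hqb, hsq, hyq⟩ := hq0
  by_cases hzero : bracket e (P.D i s) = 0
  · exact h.bracket_eq_zero hX hl hsi hs hzero
  obtain ⟨r, hr, hr'⟩ := hX.exists_radius i
  obtain ⟨k, hk⟩ := hr' hi
  have hlin : ∀ x ∈ Icc p q, bracket e (X x) = k * (bracket e (P.u x) - bracket e (P.u p)) := by
    intro x hx
    have := P.eq_of_hasDerivAt_zero (f := fun x => bracket e (X x) - k * bracket e (P.u x))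
      ((P.t_nonneg i).trans hp.1) hx.1
      ((continuous_const.bracket hX.continuous).sub
        (continuous_const.mul (continuous_const.bracket P.u_continuous))).continuousOn
      (fun m y hy hy' => by
        have hmi : m = i := by
          have h1 : P.t m < P.t (i + 1) := hy.1.trans_le (hy'.2.le.trans (hx.2.trans hq.2))
          have h2 : P.t i < P.t (m + 1) := (hp.1.trans hy'.1.le).trans_lt hy.2
          have h3 := P.t_strictMono.lt_iff_lt.mp h1
          have h4 := P.t_strictMono.lt_iff_lt.mp h2
          omega
        subst hmi
        have hc := hasDerivAt_const y e
        refine ((hc.bracket (hX.hasDerivAt hy)).sub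
          ((hc.bracket ((IsAdmissible.u P).hasDerivAt hy)).const_mul k)).congr_deriv ?_
        rw [hr y (Ioo_subset_Icc_self hy), hk y (Ioo_subset_Icc_self hy), bracket_smul_right]
        simp only [bracket_zero_left]
        ring)
    simp only [hyp] at this
    linarith
  rcases (hps.trans hsq).eq_or_lt with hpq | hpq
  · rw [show s = p from le_antisymm (hpq ▸ hsq) hps, hyp]
  -- If `k ≠ 0`, then `[e, u]` agrees at `p` and `q`, and Rolle's theorem gives a zero of `[e, u']`,
  -- which on a straight arc spreads to `s`.
  have hk0 : k = 0 := by
    by_contra hk0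
    have h1 := hlin q (right_mem_Icc.mpr hpq.le)
    rw [hyq] at h1
    have h2 : bracket e (P.u p) = bracket e (P.u q) := by
      have := (mul_eq_zero.mp h1.symm).resolve_left hk0
      linarith
    obtain ⟨y, hy, hy0⟩ := exists_hasDerivAt_eq_zero hpq
      (continuous_const.bracket P.u_continuous).continuousOn h2
      (fun y hy => (hasDerivAt_const y e).bracket
        ((IsAdmissible.u P).hasDerivAt ⟨hp.1.trans_lt hy.1, hy.2.trans_le hq.2⟩))
    rw [bracket_zero_left, zero_add] at hy0
    exact hzero (straight_bracket_eq_zero hi ⟨hp.1.trans hy.1.le, hy.2.le.trans hq.2⟩ hsi hy0)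
  rw [hlin s ⟨hps, hsq⟩, hk0, zero_mul]

end IsChordDirection

end SmoothByPartsPlane

/-! ### Rigidity of tangential curves, and the periodic and antiperiodic cases -/

namespace SmoothByPartsPlane

variable {P : SmoothByPartsPlane} {X Y : ℝ → ℝ × ℝ}

/-- An admissible curve whose position is tangent to the unit circle everywhere vanishes. -/
theorem eq_zero_of_bracket_D_eq_zero (hX : P.IsAdmissible X) {m : ℕ}
    (h : ∀ i, m ≤ i → ∀ s ∈ P.arc i, bracket (X s) (P.D i s) = 0) (s : ℝ) : X s = 0 := by
  have hconvex : ∀ i, m ≤ i → IsStrictlyConvexArc P.u (P.t i) (P.t (i + 1)) →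
      ∀ s ∈ P.arc i, X s = 0 := by
    intro i hi hc s hs
    -- Differentiating `[X, u'] = 0` gives `[X, u''] = 0`, since `[X', u'] = r [u', u'] = 0`.
    have h1 := (hX.hasDerivWithinAt hs).bracket (P.hasDerivWithinAt_D hs)
    have h2 := (hasDerivWithinAt_const s (P.arc i) (0 : ℝ)).congr (h i hi) (h i hi s hs)
    have h3 := (uniqueDiffOn_Icc (P.t_lt i) s hs).eq_deriv _ h1 h2
    obtain ⟨r, hr, -⟩ := hX.exists_radius i
    rw [hr s hs, bracket_smul_left] at h3
    have h4 : bracket (P.velocity P.u i s) (P.D i s) = 0 := bracket_self _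
    rw [h4, mul_zero, zero_add] at h3
    exact eq_zero_of_bracket_eq_zero (h i hi s hs) h3 (hc s hs)
  have hdiv : ∀ i, m ≤ i → X (P.t (i + 1)) = 0 := by
    intro i hi
    rcases P.arc_type i with hc | hc
    · exact hconvex i hi hc _ (P.right_mem_arc i)
    rcases P.arc_type (i + 1) with hc' | hc'
    · exact hconvex (i + 1) (by omega) hc' _ (P.left_mem_arc (i + 1))
    · exact eq_zero_of_bracket_eq_zero (h i hi _ (P.right_mem_arc i))
        (h (i + 1) (by omega) _ (P.left_mem_arc (i + 1))) (P.straight_vertex hc hc')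
  -- The start at `m + 1` makes both ends of the arc covered by `hdiv`; periodicity recovers the
  -- remaining parameters.
  have hall : ∀ i, m + 1 ≤ i → ∀ s ∈ P.arc i, X s = 0 := by
    intro i hi s hs
    rcases P.arc_type i with hc | hc
    · exact hconvex i (by omega) hc s hs
    obtain ⟨k, rfl⟩ := Nat.exists_eq_succ_of_ne_zero (show i ≠ 0 by omega)
    obtain ⟨r, hr, hr'⟩ := hX.exists_radius (k + 1)
    obtain ⟨c, hc'⟩ := hr' hc
    have hlin : ∀ s ∈ P.arc (k + 1), X s - c • P.u s = X (P.t (k + 1)) - c • P.u (P.t (k + 1)) := by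
      intro s hs
      refine P.eq_of_hasDerivAt_zero (f := fun s => X s - c • P.u s) (P.t_nonneg _) hs.1
        (hX.continuous.sub (P.u_continuous.const_smul c)).continuousOn fun m y hy hy' => ?_
      have hmi : m = k + 1 := by
        have h1 : P.t m < P.t (k + 1 + 1) := hy.1.trans (hy'.2.trans_le hs.2)
        have h2 : P.t (k + 1) < P.t (m + 1) := hy'.1.trans hy.2
        have h3 := P.t_strictMono.lt_iff_lt.mp h1
        have h4 := P.t_strictMono.lt_iff_lt.mp h2
        omega
      subst hmi
      have hyi := Ioo_subset_Icc_self hy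
      refine ((hX.hasDerivAt hy).sub
        (((IsAdmissible.u P).hasDerivAt hy).const_smul c)).congr_deriv ?_
      rw [hr y hyi, hc' y hyi, sub_self]
    have h1 := hlin _ (P.right_mem_arc (k + 1))
    rw [hdiv k (by omega), hdiv (k + 1) (by omega), zero_sub, zero_sub, neg_inj] at h1
    have hc0 : c = 0 := by
      have : c • (P.u (P.t (k + 1 + 1)) - P.u (P.t (k + 1))) = 0 := by
        rw [smul_sub, h1, sub_self]
      exact (smul_eq_zero.mp this).resolve_right (P.straight_endpoints_ne hc)
    have h2 := hlin s hs
    rwa [hc0, zero_smul, zero_smul, sub_zero, sub_zero, hdiv k (by omega)] at h2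
  have hper : Function.Periodic X (2 * P.T) := hX.periodic
  obtain ⟨y, hy, hys⟩ := hper.exists_mem_Ico P.two_T_pos s (P.t (m + 1))
  obtain ⟨i, hi⟩ := P.exists_mem_Ico ((P.t_nonneg (m + 1)).trans hy.1)
  have := P.t_strictMono.lt_iff_lt.mp (hy.1.trans_lt hi.2)
  rw [hys]
  exact hall i (by omega) y (Ico_subset_Icc_self hi)

/-! ### Curves of half the period -/

/-- The cross term `∫ [c, X']` vanishes because `X` is closed. -/
theorem signedArea_sub_const (hX : P.IsAdmissible X) (c : ℝ × ℝ) :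
    P.signedArea (fun s => X s - c) = P.signedArea X := by
  have hc := IsAdmissible.const P c
  have h0 : ∫ s in (0 : ℝ)..2 * P.T, bracket c (deriv X s) = 0 := by
    have := integral_bracket_comm hc hX le_rfl P.two_T_pos.le
    have hper := hX.periodic 0
    rw [zero_add] at hper
    simpa [bracket_zero_right, hper] using this
  have hi := intervalIntegrable_bracket_deriv hX hX le_rfl P.two_T_pos.le
  have hi' := intervalIntegrable_bracket_deriv hc hX le_rfl P.two_T_pos.le
  unfold signedArea mixedArea
  simp only [deriv_sub_const, bracket_sub_left]
  rw [intervalIntegral.integral_sub hi hi', h0, sub_zero]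

theorem isChordDirection_of_periodic (hT : ∀ s, X (s + P.T) = X s) {i : ℕ} {a : ℝ}
    (ha : a ∈ P.arc i) :
    P.IsChordDirection (fun s => X s - X a) (P.D i a) i (i + P.n) a (a + P.T) where
  ne_zero := P.D_ne_zero ha
  index_le := Nat.le_add_right _ _
  index_le_add := le_rfl
  left_mem := ha
  right_mem := P.add_mem_arc ha
  le := by linarith [P.T_pos]
  le_add := le_rfl
  left_eq := by simp [bracket_zero_right]
  right_eq := by simp [hT, bracket_zero_right]
  nonneg k h1 h2 s hs hsab := P.bracket_D_nonneg ha hs h1 h2 hsab.1 hsab.2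

theorem signedArea_nonpos_of_periodic (hX : P.IsAdmissible X) (hT : ∀ s, X (s + P.T) = X s) :
    P.signedArea X ≤ 0 := by
  have h0 := P.left_mem_arc 0
  rw [← signedArea_sub_const hX (X (P.t 0)),
    signedArea_eq (hX.sub (IsAdmissible.const P _)) (one_mul 1) (fun s => by simp [hT]) (P.t 0)]
  exact (isChordDirection_of_periodic hT h0).integral_nonpos (hX.sub (IsAdmissible.const P _))

/-- The tangent direction of the unit circle is not constant. -/
theorem exists_bracket_D_ne_zero (P : SmoothByPartsPlane) (e : ℝ × ℝ) (he : e ≠ 0) :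
    ∃ i, ∃ s ∈ P.arc i, bracket e (P.D i s) ≠ 0 := by
  by_contra hcon
  push Not at hcon
  have h1 := P.eq_of_hasDerivAt_zero (f := fun s => bracket e (P.u s)) le_rfl P.T_pos.le
    (continuous_const.bracket P.u_continuous).continuousOn (fun i s hs _ => by
      refine ((hasDerivAt_const s e).bracket
        ((IsAdmissible.u P).hasDerivAt hs)).congr_deriv ?_
      rw [bracket_zero_left, zero_add]
      exact hcon i s (Ioo_subset_Icc_self hs))
  have h2 := P.u_antiperiodic 0
  rw [zero_add] at h2
  rw [h2, bracket_neg_right] at h1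
  have h3 : bracket e (P.u (P.t 0)) = 0 := by rw [P.t_zero]; linarith
  have h4 := hcon 0 (P.t 0) (P.left_mem_arc 0)
  have h5 := P.bracket_u_D_pos (P.left_mem_arc 0)
  exact h5.ne' (bracket_eq_zero_of_bracket_eq_zero he h3 h4)

/-- The half turn may start at any parameter, so equality puts the curve on a line parallel to every
tangent of the unit circle; two independent tangents leave a single point. -/
theorem eq_of_signedArea_eq_zero_of_periodic (hX : P.IsAdmissible X)
    (hT : ∀ s, X (s + P.T) = X s) (h0 : P.signedArea X = 0) (r s : ℝ) : X r = X s := by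
  have key : ∀ i, ∀ a ∈ P.arc i, ∀ s, bracket (P.D i a) (X s) = bracket (P.D i a) (X a) := by
    intro i a ha s
    have hadm := hX.sub (IsAdmissible.const P (X a))
    rw [← signedArea_sub_const hX (X a),
      signedArea_eq hadm (one_mul 1) (fun s => by simp [hT]) a] at h0
    obtain ⟨y, hy, hys⟩ := Function.Periodic.exists_mem_Ico (f := X) (c := P.T) hT P.T_pos s a
    have := (isChordDirection_of_periodic hT ha).bracket_eq_zero_of_integral_eq_zero hadm h0
      (Ico_subset_Icc_self hy)
    rw [hys]
    rw [bracket_sub_right] at this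
    linarith
  have ha := P.left_mem_arc 0
  obtain ⟨i, b, hb, hne⟩ := P.exists_bracket_D_ne_zero _ (P.D_ne_zero ha)
  rw [← sub_eq_zero]
  refine eq_zero_of_bracket_eq_zero (a := P.D 0 (P.t 0)) (b := P.D i b) ?_ ?_ hne
  · rw [bracket_swap, bracket_sub_right, key 0 _ ha r, key 0 _ ha s, sub_self, neg_zero]
  · rw [bracket_swap, bracket_sub_right, key i b hb r, key i b hb s, sub_self, neg_zero]

/-! ### Centrally symmetric curves of mean width zero -/

theorem integral_half_turn_eq_zero (hX : P.IsAdmissible X)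
    (hT : ∀ s, X (s + P.T) = -X s) (h0 : ∫ s in (0 : ℝ)..2 * P.T, bracket (X s) (deriv P.u s) = 0)
    (a : ℝ) : ∫ s in a..a + P.T, bracket (X s) (deriv P.u s) = 0 := by
  have := integral_eq_two_mul hX (IsAdmissible.u P) (ε := -1) (by norm_num)
    (fun s => by rw [hT, neg_one_smul]) (fun s => by rw [P.u_antiperiodic, neg_one_smul]) a
  linarith

/-- A centrally symmetric curve of mean width zero is somewhere tangent to the unit circle. -/
theorem exists_isChordDirection (hX : P.IsAdmissible X) (hT : ∀ s, X (s + P.T) = -X s)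
    (h0 : ∫ s in (0 : ℝ)..2 * P.T, bracket (X s) (deriv P.u s) = 0) :
    ∃ e j l a, P.IsChordDirection X e j l a (a + P.T) ∧ bracket (P.u a) e ≠ 0 := by
  have hTpos := P.T_pos
  by_cases h1 : ∃ i, ∃ s ∈ P.arc i, bracket (X s) (P.D i s) = 0
  · obtain ⟨i, a, ha, h⟩ := h1
    have h' : bracket (P.D i a) (X a) = 0 := by rw [bracket_swap, h, neg_zero]
    exact ⟨P.D i a, i, i + P.n, a, {
      ne_zero := P.D_ne_zero ha
      index_le := Nat.le_add_right _ _
      index_le_add := le_rfl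
      left_mem := ha
      right_mem := P.add_mem_arc ha
      le := by linarith
      le_add := le_rfl
      left_eq := h'
      right_eq := by rw [hT, bracket_neg_right, h', neg_zero]
      nonneg := fun k h1 h2 s hs hsab => P.bracket_D_nonneg ha hs h1 h2 hsab.1 hsab.2 },
      (P.bracket_u_D_pos ha).ne'⟩
  push Not at h1
  by_cases h2 : ∃ i, bracket (X (P.t (i + 1))) (P.D i (P.t (i + 1))) *
      bracket (X (P.t (i + 1))) (P.D (i + 1) (P.t (i + 1))) < 0
  · obtain ⟨i, hneg⟩ := h2
    have hn := P.n_pos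
    set a := P.t (i + 1) with ha
    have hm1 : a ∈ P.arc i := P.right_mem_arc i
    have hm2 : a ∈ P.arc (i + 1) := P.left_mem_arc (i + 1)
    set α := bracket (X a) (P.D i a) with hα
    set β := bracket (X a) (P.D (i + 1) a) with hβ
    have hα0 : 0 < |α| := abs_pos.mpr (h1 i a hm1)
    have hβ0 : 0 < |β| := abs_pos.mpr (h1 (i + 1) a hm2)
    have hsum : |β| * α + |α| * β = 0 := by
      rcases mul_neg_iff.mp hneg with ⟨h, h'⟩ | ⟨h, h'⟩
      · rw [abs_of_neg h', abs_of_pos h]; ring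
      · rw [abs_of_pos h', abs_of_neg h]; ring
    -- As `α` and `β` have opposite signs, this positive combination of the one-sided tangents is
    -- parallel to `X a`. The half turn runs from arc `i + 1`, just after the vertex, to arc `i +
    -- n`, just before its antipode.
    have hu : 0 < bracket (P.u a) (|β| • P.D i a + |α| • P.D (i + 1) a) := by
      rw [bracket_add_right, bracket_smul_right, bracket_smul_right]
      exact add_pos (mul_pos hβ0 (P.bracket_u_D_pos hm1)) (mul_pos hα0 (P.bracket_u_D_pos hm2))
    have h' : bracket (|β| • P.D i a + |α| • P.D (i + 1) a) (X a) = 0 := by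
      rw [bracket_swap, bracket_add_right, bracket_smul_right, bracket_smul_right, ← hα, ← hβ,
        hsum, neg_zero]
    refine ⟨_, i + 1, i + P.n, a, {
      ne_zero := fun h => hu.ne' (by rw [h, bracket_zero_right])
      index_le := by omega
      index_le_add := by omega
      left_mem := hm2
      right_mem := P.add_mem_arc hm1
      le := by linarith
      le_add := le_rfl
      left_eq := h'
      right_eq := by rw [hT, bracket_neg_right, h', neg_zero]
      nonneg := fun k h1 h2 s hs hsab => ?_ }, hu.ne'⟩
    rw [bracket_add_left, bracket_smul_left, bracket_smul_left]
    exact add_nonneg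
      (mul_nonneg hβ0.le (P.bracket_D_nonneg hm1 hs (by omega) h2 hsab.1 hsab.2))
      (mul_nonneg hα0.le (P.bracket_D_nonneg hm2 hs h1 (by omega) hsab.1 hsab.2))
  push Not at h2
  exfalso
  -- Otherwise `[X, u']` keeps one sign on each arc and across each vertex, against its vanishing
  -- integral.
  have harc : ∀ i, ∀ r ∈ P.arc i, ∀ s ∈ P.arc i,
      0 < bracket (X r) (P.D i r) * bracket (X s) (P.D i s) := fun i r hr s hs =>
    mul_pos_of_continuousOn_of_ne_zero (f := fun s => bracket (X s) (P.D i s)) ordConnected_Icc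
      (hX.continuous.continuousOn.bracket (P.continuousOn_D i)) (h1 i) hr hs
  set σ := bracket (X (P.t 0)) (P.D 0 (P.t 0)) with hσ
  have hall : ∀ i, ∀ s ∈ P.arc i, 0 < σ * bracket (X s) (P.D i s) := by
    have trans : ∀ x y z : ℝ, 0 < x * y → 0 < y * z → 0 < x * z := fun x y z h h' => by
      have : 0 < (x * z) * y ^ 2 := by
        calc 0 < (x * y) * (y * z) := mul_pos h h'
          _ = _ := by ring
      exact pos_of_mul_pos_left this (sq_nonneg y)
    intro i
    induction i with
    | zero => exact fun s hs => harc 0 _ (P.left_mem_arc 0) s hs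
    | succ i ih =>
      intro s hs
      have hm1 := P.right_mem_arc i
      have hm2 := P.left_mem_arc (i + 1)
      have h3 := lt_of_le_of_ne (h2 i) (mul_ne_zero (h1 i _ hm1) (h1 (i + 1) _ hm2)).symm
      exact trans _ _ _ (trans _ _ _ (ih _ hm1) h3) (harc (i + 1) _ hm2 s hs)
  have hpos := integral_bracket_pos (hX.smul σ) (IsAdmissible.u P) fun i s hs => by
    rw [bracket_smul_left]; exact hall i s hs
  simp only [bracket_smul_left, intervalIntegral.integral_const_mul, h0, mul_zero] at hpos
  exact lt_irrefl _ hpos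

theorem signedArea_nonpos_of_antiperiodic (hX : P.IsAdmissible X) (hT : ∀ s, X (s + P.T) = -X s)
    (h0 : ∫ s in (0 : ℝ)..2 * P.T, bracket (X s) (deriv P.u s) = 0) : P.signedArea X ≤ 0 := by
  obtain ⟨e, j, l, a, h, -⟩ := exists_isChordDirection hX hT h0
  rw [signedArea_eq hX (ε := -1) (by norm_num) (fun s => by rw [hT, neg_one_smul]) a]
  exact h.integral_nonpos hX

/-- Tangency along a half turn propagates by central symmetry. -/
theorem bracket_D_eq_zero_of_half_turn (hT : ∀ s, X (s + P.T) = -X s) {j l : ℕ} {a : ℝ}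
    (hl : l ≤ j + P.n) (ha : a ∈ P.arc j) (hb : a + P.T ∈ P.arc l)
    (h : ∀ i, j ≤ i → i ≤ l → ∀ s ∈ P.arc i, s ∈ Icc a (a + P.T) → bracket (X s) (P.D i s) = 0)
    (i : ℕ) (hi : j ≤ i) : ∀ s ∈ P.arc i, bracket (X s) (P.D i s) = 0 := by
  have hn := P.n_pos
  have hadd : ∀ i s, bracket (X (s + P.T)) (P.D (i + P.n) (s + P.T)) = bracket (X s) (P.D i s) :=
    fun i s => by rw [hT, P.D_add, bracket_neg_left, bracket_neg_right, neg_neg]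
  have hjl : j + P.n ≤ l + 1 := by
    rw [← P.t_strictMono.le_iff_le, P.t_add]
    linarith [ha.1, hb.2]
  have hTn := P.t_add j
  induction i using Nat.strong_induction_on with
  | _ i ih =>
    intro s hs
    by_cases hin : j + P.n ≤ i
    · obtain ⟨k, rfl⟩ := Nat.exists_eq_add_of_le' (show P.n ≤ i by omega)
      have hs' : s - P.T ∈ P.arc k := by
        have h1 := P.t_add k
        have h2 := P.t_add (k + 1)
        rw [show k + 1 + P.n = k + P.n + 1 by ring] at h2
        exact ⟨by linarith [hs.1], by linarith [hs.2]⟩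
      have := hadd k (s - P.T)
      rw [sub_add_cancel] at this
      rw [this]
      exact ih k (by omega) (by omega) _ hs'
    have htop : P.t (i + 1) ≤ a + P.T := by
      have : P.t (i + 1) ≤ P.t (j + P.n) := P.t_strictMono.monotone (by omega)
      linarith [ha.1]
    rcases le_or_gt a s with has | has
    · exact h i hi (by omega) s hs ⟨has, hs.2.trans htop⟩
    · have hij : i = j := by
        have := P.t_strictMono.lt_iff_lt.mp (hs.1.trans_lt (has.trans_le ha.2))
        omega
      subst hij
      -- The part of the first arc before `a` is reached from its antipode, which lies in the half
      -- turn before `a + T`.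
      have hlj : l = i + P.n := by
        have h1 : P.t (i + P.n) < P.t (l + 1) := by
          rw [P.t_add]; linarith [hs.1, hb.2]
        have := P.t_strictMono.lt_iff_lt.mp h1
        omega
      rw [← hadd]
      refine h (i + P.n) (by omega) hlj.ge _ (P.add_mem_arc hs) ⟨?_, by linarith⟩
      have : P.t (i + 1) ≤ P.t (i + P.n) := P.t_strictMono.monotone (by omega)
      linarith [ha.2, hs.1]

/-- Equality keeps `X` on `ℝ e` over a half turn. Where `u'` is not parallel to `e` this forces `r =
0`, so `X` rests at one point `X r`; elsewhere `[X, u']` vanishes. Thus `[X, u'] = [X r, u']`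
throughout, and the vanishing integral gives `[X r, u a] = 0`. Since `X r` lies on `ℝ e` and `[u a,
e] ≠ 0`, it is `0`. -/
theorem eq_zero_of_signedArea_eq_zero_of_antiperiodic (hX : P.IsAdmissible X)
    (hT : ∀ s, X (s + P.T) = -X s)
    (h0 : ∫ s in (0 : ℝ)..2 * P.T, bracket (X s) (deriv P.u s) = 0)
    (hA : P.signedArea X = 0) (s : ℝ) : X s = 0 := by
  obtain ⟨e, j, l, a, h, hue⟩ := exists_isChordDirection hX hT h0
  rw [signedArea_eq hX (ε := -1) (by norm_num) (fun s => by rw [hT, neg_one_smul]) a] at hA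
  have hy : ∀ s ∈ Icc a (a + P.T), bracket e (X s) = 0 := fun s hs =>
    h.bracket_eq_zero_of_integral_eq_zero hX hA hs
  refine eq_zero_of_bracket_D_eq_zero hX (m := j)
    (bracket_D_eq_zero_of_half_turn hT h.index_le_add h.left_mem h.right_mem ?_) s
  by_cases hex : ∃ k r, j ≤ k ∧ k ≤ l ∧ r ∈ P.arc k ∧ r ∈ Icc a (a + P.T) ∧
      bracket e (P.D k r) ≠ 0
  swap
  · push Not at hex
    exact fun i hj hl s hs hsab =>
      bracket_eq_zero_of_bracket_eq_zero h.ne_zero (hy s hsab) (hex i s hj hl hs hsab)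
  obtain ⟨k, r, hjk, hkl, hrk, hr, hne⟩ := hex
  have hconst : ∀ i m x y, j ≤ i → i ≤ m → m ≤ l → x ∈ P.arc i → y ∈ P.arc m → a ≤ x → x ≤ y →
      y ≤ a + P.T → bracket e (P.D i x) ≠ 0 → bracket e (P.D m y) ≠ 0 → X y = X x := by
    intro i m x y hji him hml hx hy' hax hxy hyb hx0 hy0
    have hx1 := lt_of_le_of_ne (h.nonneg i hji (him.trans hml) x hx ⟨hax, hxy.trans hyb⟩) hx0.symm
    have hy1 := lt_of_le_of_ne (h.nonneg m (hji.trans him) hml y hy' ⟨hax.trans hxy, hyb⟩) hy0.symm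
    refine P.eq_of_hasDerivAt_zero (h.nonneg_left.trans hax) hxy hX.continuous.continuousOn
      fun c z hz hzxy => ?_
    have hzc := Ioo_subset_Icc_self hz
    have h1 := P.t_strictMono.lt_iff_lt.mp (hx.1.trans_lt (hzxy.1.trans hz.2))
    have h2 := P.t_strictMono.lt_iff_lt.mp (hz.1.trans_le (hzxy.2.le.trans hy'.2))
    have hq := h.ne_zero_between (i := i) (k := c) (m := m) hji (by omega) (by omega) hml hx hzc hy'
      hax hzxy.1.le hzxy.2.le hyb hx1 hy1
    obtain ⟨ρ, hρ, -⟩ := hX.exists_radius c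
    have hzab : z ∈ Ioo a (a + P.T) := ⟨hax.trans_lt hzxy.1, hzxy.2.trans_le hyb⟩
    have hd := (hasDerivAt_const z e).bracket (hX.hasDerivAt hz)
    have hev : (fun s => bracket e (X s)) =ᶠ[nhds z] fun _ => 0 := by
      filter_upwards [Icc_mem_nhds hzab.1 hzab.2] with w hw using hy w hw
    have hz0 := hd.unique ((hasDerivAt_const z (0 : ℝ)).congr_of_eventuallyEq hev)
    rw [bracket_zero_left, zero_add, hρ z hzc, bracket_smul_right] at hz0
    have hρ0 : ρ z = 0 := (mul_eq_zero.mp hz0).resolve_right hq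
    have := hX.hasDerivAt hz
    rwa [hρ z hzc, hρ0, zero_smul] at this
  have hdiff : ∀ i, j ≤ i → i ≤ l → ∀ s ∈ P.arc i, s ∈ Icc a (a + P.T) →
      bracket (X s) (P.D i s) = bracket (X r) (P.D i s) := by
    intro i hj hl s hs hsab
    by_cases hs0 : bracket e (P.D i s) = 0
    · rw [bracket_eq_zero_of_bracket_eq_zero h.ne_zero (hy s hsab) hs0,
        bracket_eq_zero_of_bracket_eq_zero h.ne_zero (hy r hr) hs0]
    · congr 1
      rcases lt_trichotomy i k with hik | rfl | hki
      · exact (hconst i k s r hj hik.le hkl hs hrk hsab.1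
          (hs.2.trans ((P.t_strictMono.monotone hik).trans hrk.1)) hr.2 hs0 hne).symm
      · rcases le_total s r with hsr | hsr
        · exact (hconst i i s r hj le_rfl hkl hs hrk hsab.1 hsr hr.2 hs0 hne).symm
        · exact hconst i i r s hj le_rfl hkl hrk hs hr.1 hsr hsab.2 hne hs0
      · exact hconst k i r s hjk hki.le hl hrk hs hr.1
          (hrk.2.trans ((P.t_strictMono.monotone hki).trans hs.1)) hsab.2 hne hs0
  have hint := integral_half_turn_eq_zero hX hT h0 a
  have hu := IsAdmissible.u P
  rw [integral_eq_primitive_sub hX hu h.nonneg_left (h.nonneg_left.trans h.le)] at hint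
  have hc := P.eq_of_hasDerivAt_zero (f := fun s => primitive X P.u s - bracket (X r) (P.u s))
    h.nonneg_left h.le ((continuousOn_primitive hX hu h.nonneg_left).sub
      (continuous_const.bracket P.u_continuous).continuousOn) (fun i s hs hsab => by
      have hsab' := Ioo_subset_Icc_self hsab
      have hb := h.index_bounds hs hsab'
      refine ((hasDerivAt_primitive hX hu hs).sub
        ((hasDerivAt_const s (X r)).bracket (hu.hasDerivAt hs))).congr_deriv ?_
      rw [bracket_zero_left, zero_add]
      exact sub_eq_zero.mpr (hdiff i hb.1 hb.2 s (Ioo_subset_Icc_self hs) hsab'))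
  rw [P.u_antiperiodic, bracket_neg_right] at hc
  have hXr : X r = 0 := by
    refine eq_zero_of_bracket_eq_zero (a := P.u a) (b := e) (by linarith) ?_ hue
    rw [bracket_swap, hy r hr, neg_zero]
  intro i hj hl s hs hsab
  rw [hdiff i hj hl s hs hsab, hXr, bracket_zero_left]

end SmoothByPartsPlane

namespace SmoothByPartsPlane

variable {P : SmoothByPartsPlane} {γ : ℝ → ℝ × ℝ}

/-! ### Dual length and mean width -/

variable (P) in
/-- The integral `∫ [X, u']` over a period. -/
noncomputable def tangentIntegral (X : ℝ → ℝ × ℝ) : ℝ :=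
  ∫ s in (0 : ℝ)..2 * P.T, bracket (X s) (deriv P.u s)

theorem tangentIntegral_u_pos (P : SmoothByPartsPlane) : 0 < P.tangentIntegral P.u :=
  integral_bracket_pos (IsAdmissible.u P) (IsAdmissible.u P) fun _ _ hs => P.bracket_u_D_pos hs

theorem signedArea_u (P : SmoothByPartsPlane) :
    P.signedArea P.u = 1 / 2 * P.tangentIntegral P.u := rfl

/-- Off the division points `r [u, u'] = [u, γ']`; integration by parts for closed curves exchanges
`u` and `γ`. -/
theorem dualLength_eq (hγ : P.IsAdmissible γ) : P.dualLength γ = P.tangentIntegral γ := by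
  have hu := IsAdmissible.u P
  have h1 : P.dualLength γ = ∫ s in (0 : ℝ)..2 * P.T, bracket (P.u s) (deriv γ s) := by
    refine intervalIntegral.integral_congr_ae ?_
    filter_upwards [(countable_range P.t).ae_notMem MeasureTheory.volume] with s hs hs'
    rw [uIoc_of_le P.two_T_pos.le] at hs'
    obtain ⟨i, hi⟩ := P.exists_mem_Ico hs'.1.le
    have hi' : s ∈ Ioo (P.t i) (P.t (i + 1)) :=
      ⟨lt_of_le_of_ne hi.1 fun h => hs ⟨i, h⟩, hi.2⟩
    have hpos := P.bracket_u_D_pos (Ioo_subset_Icc_self hi')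
    rw [curvatureRadius, hu.deriv_eq hi', div_mul_cancel₀ _ hpos.ne']
  have h2 := integral_bracket_comm hγ hu le_rfl P.two_T_pos.le
  have h3 := hγ.periodic 0
  have h4 := P.u_add_two_mul 0
  rw [zero_add] at h3 h4
  rw [h3, h4, sub_self, sub_eq_zero] at h2
  rw [h1, ← h2]; rfl

theorem tangentIntegral_comp_add (hγ : P.IsAdmissible γ) :
    P.tangentIntegral (fun s => γ (s + P.T)) = -P.tangentIntegral γ := by
  have hd : ∀ s, deriv P.u (s + P.T) = -deriv P.u s := fun s => by
    rw [← neg_one_smul ℝ (deriv P.u s)]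
    exact deriv_add_half_period (fun s => by rw [P.u_antiperiodic, neg_one_smul]) s
  have hper : Function.Periodic (fun s => bracket (γ s) (deriv P.u s)) (2 * P.T) := by
    intro s
    have : deriv P.u (s + 2 * P.T) = deriv P.u s := by
      rw [two_mul, ← add_assoc, hd, hd, neg_neg]
    simp only [hγ.periodic, this]
  have h1 := hper.intervalIntegral_add_eq P.T 0
  rw [zero_add] at h1
  unfold tangentIntegral
  rw [← h1, add_comm P.T, ← intervalIntegral.integral_neg]
  have h2 := intervalIntegral.integral_comp_add_right (a := 0) (b := 2 * P.T)
    (fun s => -bracket (γ s) (deriv P.u s)) P.T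
  rw [zero_add] at h2
  rw [← h2]
  simp only [hd, bracket_neg_right, neg_neg]

/-- The difference of opposite points, reduced by a multiple of the unit circle. -/
theorem tangentIntegral_difference (hγ : P.IsAdmissible γ) (c : ℝ) :
    P.tangentIntegral (fun s => γ s - γ (s + P.T) - c • P.u s) =
      2 * P.tangentIntegral γ - c * P.tangentIntegral P.u := by
  have hu := IsAdmissible.u P
  have h := tangentIntegral_comp_add hγ
  have i1 := intervalIntegrable_bracket_deriv hγ hu le_rfl P.two_T_pos.le
  have i2 := intervalIntegrable_bracket_deriv hγ.comp_add hu le_rfl P.two_T_pos.le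
  have i3 := intervalIntegrable_bracket_deriv hu hu le_rfl P.two_T_pos.le
  unfold tangentIntegral at *
  simp only [bracket_sub_left, bracket_smul_left]
  rw [intervalIntegral.integral_sub (i1.sub i2) (i3.const_mul c),
    intervalIntegral.integral_sub i1 i2, intervalIntegral.integral_const_mul, h]
  ring

theorem isAdmissible_difference (hγ : P.IsAdmissible γ) (c : ℝ) :
    P.IsAdmissible (fun s => γ s - γ (s + P.T) - c • P.u s) :=
  (hγ.sub hγ.comp_add).sub ((IsAdmissible.u P).smul c)

/-- The factor 2 comes from the one half in the area of the unit ball; it cancels the 2 in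
`tangentIntegral_difference`. -/
theorem meanWidth_eq (hγ : P.IsAdmissible γ) :
    P.meanWidth γ * P.tangentIntegral P.u = 2 * P.tangentIntegral γ := by
  have h := (tangentIntegral_u_pos P).ne'
  rw [meanWidth, dualLength_eq hγ, signedArea_u]
  field_simp

theorem bracket_v {i : ℕ} {s : ℝ} (x : ℝ × ℝ) :
    bracket x (P.v i s) = bracket x (P.D i s) / bracket (P.u s) (P.D i s) := by
  rw [v, bracket_smul_right, inv_mul_eq_div]

theorem width_eq {i : ℕ} {s : ℝ} (hs : s ∈ P.arc i) (c : ℝ) :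
    bracket (γ (s + P.T)) (P.v (i + P.n) (s + P.T)) + bracket (γ s) (P.v i s) = c ↔
      bracket (γ s - γ (s + P.T) - c • P.u s) (P.D i s) = 0 := by
  have hpos := (P.bracket_u_D_pos hs).ne'
  rw [bracket_v, bracket_v, P.D_add, P.u_antiperiodic]
  simp only [bracket_neg_left, bracket_neg_right, neg_neg, bracket_sub_left, bracket_smul_left]
  rw [← add_div, div_eq_iff hpos]
  constructor <;> intro h <;> linarith

/-- Width `c` means that `γ(s) - γ(s + T) - c u(s)` is everywhere parallel to `u'`, hence zero by
rigidity; integrating against `u'` identifies `c` with the mean width. -/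
theorem hasConstantWidth_iff (hγ : P.IsAdmissible γ) :
    P.HasConstantWidth γ ↔ ∀ s, P.constantWidthMeasureSet γ s = 0 := by
  have hpos := tangentIntegral_u_pos P
  constructor
  · rintro ⟨c, hc⟩
    have h0 := eq_zero_of_bracket_D_eq_zero (isAdmissible_difference hγ c) (m := 0)
      fun i _ s hs => (width_eq hs c).mp (hc i s hs)
    have h1 := tangentIntegral_difference hγ c
    rw [← meanWidth_eq hγ] at h1
    have h2 : P.tangentIntegral (fun s => γ s - γ (s + P.T) - c • P.u s) = 0 := by
      unfold tangentIntegral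
      simp only [h0, bracket_zero_left, intervalIntegral.integral_zero]
    have h3 : P.meanWidth γ = c := by
      have : (P.meanWidth γ - c) * P.tangentIntegral P.u = 0 := by linarith
      exact sub_eq_zero.mp ((mul_eq_zero.mp this).resolve_right hpos.ne')
    intro s
    rw [constantWidthMeasureSet, h3, h0, smul_zero]
  · intro h
    refine ⟨P.meanWidth γ, fun i s hs => (width_eq hs _).mpr ?_⟩
    have := (smul_eq_zero.mp (h s)).resolve_left (by norm_num)
    rw [this, bracket_zero_left]

theorem constantWidthMeasureSet_antiperiodic (hγ : P.IsAdmissible γ) (s : ℝ) :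
    P.constantWidthMeasureSet γ (s + P.T) = -P.constantWidthMeasureSet γ s := by
  have h := hγ.periodic s
  rw [two_mul, ← add_assoc] at h
  simp only [constantWidthMeasureSet]
  rw [h, P.u_antiperiodic, ← smul_neg, smul_neg]
  congr 1
  abel

theorem tangentIntegral_constantWidthMeasureSet (hγ : P.IsAdmissible γ) :
    ∫ s in (0 : ℝ)..2 * P.T, bracket (P.constantWidthMeasureSet γ s) (deriv P.u s) = 0 := by
  have := tangentIntegral_difference hγ (P.meanWidth γ)
  rw [meanWidth_eq hγ, sub_self] at this
  unfold tangentIntegral at this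
  simp only [constantWidthMeasureSet, bracket_smul_left, intervalIntegral.integral_const_mul,
    this, mul_zero]

theorem wignerCaustic_periodic (hγ : P.IsAdmissible γ) (s : ℝ) :
    P.wignerCaustic γ (s + P.T) = P.wignerCaustic γ s := by
  have h := hγ.periodic s
  rw [two_mul, ← add_assoc] at h
  rw [wignerCaustic, wignerCaustic, h, add_comm]

theorem isSymmetric_iff : P.IsSymmetric γ ↔ ∃ p, ∀ s, P.wignerCaustic γ s = p := by
  refine exists_congr fun p => forall_congr' fun s => ?_
  rw [wignerCaustic, one_div, inv_smul_eq_iff₀ two_ne_zero, two_smul, neg_sub, sub_eq_iff_eq_add',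
    ← add_sub_assoc, eq_sub_iff_add_eq, add_comm]

theorem signedArea_of_eq_const {X : ℝ → ℝ × ℝ} {p : ℝ × ℝ} (h : ∀ s, X s = p) :
    P.signedArea X = 0 := by
  rw [funext h]
  simp [signedArea, mixedArea, bracket_zero_right]

end SmoothByPartsPlane

/-! ### The two area inequalities and their equality cases -/

theorem mainTheorem4 (P : SmoothByPartsPlane) (γ : ℝ → ℝ × ℝ) (hγ : P.IsAdmissible γ) :
    (P.signedArea (P.wignerCaustic γ) ≤ 0 ∧
      (P.signedArea (P.wignerCaustic γ) = 0 ↔ P.IsSymmetric γ)) ∧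
    (P.signedArea (P.constantWidthMeasureSet γ) ≤ 0 ∧
      (P.signedArea (P.constantWidthMeasureSet γ) = 0 ↔ P.HasConstantWidth γ)) := by
  open SmoothByPartsPlane in
  have hW : P.IsAdmissible (P.wignerCaustic γ) := (hγ.add hγ.comp_add).smul (1 / 2)
  have hWT := wignerCaustic_periodic hγ
  have hC : P.IsAdmissible (P.constantWidthMeasureSet γ) :=
    (isAdmissible_difference hγ (P.meanWidth γ)).smul (1 / 2)
  have hCT := constantWidthMeasureSet_antiperiodic hγ
  have hC0 := tangentIntegral_constantWidthMeasureSet hγ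
  refine ⟨⟨signedArea_nonpos_of_periodic hW hWT, fun h => ?_, fun h => ?_⟩,
    ⟨signedArea_nonpos_of_antiperiodic hC hCT hC0, fun h => ?_, fun h => ?_⟩⟩
  · exact isSymmetric_iff.mpr ⟨P.wignerCaustic γ 0,
      fun s => eq_of_signedArea_eq_zero_of_periodic hW hWT h s 0⟩
  · obtain ⟨p, hp⟩ := isSymmetric_iff.mp h
    exact signedArea_of_eq_const hp
  · exact (hasConstantWidth_iff hγ).mpr
      (eq_zero_of_signedArea_eq_zero_of_antiperiodic hC hCT hC0 h)
  · exact signedArea_of_eq_const ((hasConstantWidth_iff hγ).mp h)
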